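/- Let $({\cal A},*,\tau)$ be a finite von Neumann algebra with normalised trace: a unital complex $*$-algebra with a linear form $\tau$ such that $\tau(a^*)=\overline{\tau(a)}$, $\tau(ab)=\tau(ba)$, $\tau(1)=1$, $\tau(a^*a)\ge 0$ with equality only for $a=0$; such that left multiplications are bounded for the scalar product $\langle a,b\rangle=\tau(ab^*)$, the Hilbert completion ${\cal A}_2$ of ${\cal A}$ is separable, the image of ${\cal A}$ in ${\cal B}({\cal A}_2)$ is closed in the strong operator topology, and $\tau(\sup_n a_n)=\sup_n\tau(a_n)$ for bounded increasing sequences of self-adjoint elements. A projective Hilbert ${\cal A}$-module is a Hilbert space $W$ with a left ${\cal A}$-module structure such that $(ax,y)=(x,a^*y)$, which embeds isometrically and ${\cal A}$-linearly in ${\cal A}_2\hat\otimes H$ for some Hilbert space $H$; it is finitely generated if $H$ can be taken finite dimensional. Morphisms are the continuous ${\cal A}$-linear maps. A morphism $V\to W$ is ${\cal A}$-compact if it is a limit in operator norm of morphisms $V\to W$ whose images have finitely generated closures. A montelian ${\cal A}$-module is given by projective Hilbert ${\cal A}$-modules $W(t)$, $0<t\le t_0$ (for some $t_0>0$), and morphisms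 $\rho_t^{t'}:W(t)\to W(t')$ for $0<t'\le t\le t_0$ such that $\rho_t^t=\mathrm{id}$, $\rho_{t'}^{t''}\rho_t^{t'}=\rho_t^{t''}$, and $\rho_t^{t'}$ is ${\cal A}$-compact for $t'<t$; two such data that agree for all small $t$ are identified. A morphism $V\to W$ is a family of morphisms $\phi(t):V(t)\to W(t)$, defined for small $t>0$ and commuting with the $\rho$'s, two families being identified if they agree for all small $t$. A finitely generated projective Hilbert module $L$ is viewed as the montelian module $W(t)=L$, $\rho=\mathrm{id}$. Complexes are cochain complexes indexed by ${\mathbb Z}$; a complex is finite if only finitely many of its terms are nonzero. Put $W_*(t)=\varprojlim_{r<t}W(r)$, and, for a complex $F^\bullet$ of montelian modules and small $t>0$, let $H^i_*(t,F^\bullet)$ be the (algebraic) $i$-th cohomology of the complex $F^\bullet_*(t)$. A morphism of complexes $\sigma:F^\bullet\to G^\bullet$ induces, for small $t'\le t$, maps $(\sigma^i)_t^{t'}:H^i_*(t,F^\bullet)\to H^i_*(t',G^\bullet)$ (apply $\sigma$ and restrict from $t$ to $t'$). It is a qi-morphism of order $q$ if, for all small $t'\le t$, $(\sigma^i)_t^{t'}$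 is bijective for $i>q$ (how small may depend on $i$) and surjective for $i=q$; it is a qi-morphism if this holds for every $q\in{\mathbb Z}$. The complex $F^\bullet$ is qhtf if its identity is a qi-morphism. **Proposition.** Let $F^\bullet$ be a finite (resp. bounded above) qhtf complex of montelian ${\cal A}$-modules. 1. There are a finite (resp. bounded above) complex $P^\bullet$ of finitely generated projective Hilbert ${\cal A}$-modules and a qi-morphism $P^\bullet\to F^\bullet$. 2. For every finite (resp. bounded above) complex $Q^\bullet$ of finitely generated projective Hilbert ${\cal A}$-modules and every morphism of complexes $\phi:Q^\bullet\to F^\bullet$, there are a finite (resp. bounded above) complex $P^\bullet$ of finitely generated projective Hilbert ${\cal A}$-modules, a qi-morphism $\sigma:P^\bullet\to F^\bullet$ and a morphism of complexes $\psi:Q^\bullet\to P^\bullet$ such that $\phi=\sigma\psi$. -/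

import Mathlib

open CategoryTheory Filter Topology

universe u v

noncomputable section

/-- A unital complex `*`-algebra `A` with a faithful positive tracial state `τ`, such that every
left multiplication is bounded for the norm `‖b‖ = τ(b* b)^(1/2)`. -/
structure TracialAlgebra (A : Type u) [Ring A] [Algebra ℂ A] [StarRing A] [StarModule ℂ A] where
  τ : A →ₗ[ℂ] ℂ
  map_star : ∀ a, τ (star a) = starRingEnd ℂ (τ a)
  tracial : ∀ a b, τ (a * b) = τ (b * a)
  map_one : τ 1 = 1
  nonneg : ∀ a, 0 ≤ (τ (star a * a)).re
  definite : ∀ a, τ (star a * a) = 0 → a = 0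
  bounded : ∀ a, ∃ C : ℝ, ∀ b,
    (τ (star (a * b) * (a * b))).re ≤ C ^ 2 * (τ (star b * b)).re

section Standard

variable {A : Type u} [Ring A] [Algebra ℂ A] [StarRing A] [StarModule ℂ A]

namespace TracialAlgebra

variable (T : TracialAlgebra A)

/-- The algebra `A`, seen as a pre-Hilbert space. -/
def Pre (_T : TracialAlgebra A) : Type u := A

/-- The underlying element of the algebra. -/
def Pre.val {T : TracialAlgebra A} (x : T.Pre) : A := x

instance : AddCommGroup T.Pre := inferInstanceAs (AddCommGroup A)
instance : Module ℂ T.Pre := inferInstanceAs (Module ℂ A)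
instance : Module A T.Pre := inferInstanceAs (Module A A)
instance : IsScalarTower ℂ A T.Pre := inferInstanceAs (IsScalarTower ℂ A A)

/-- The scalar product `⟪x, y⟫ = τ(x* y) = τ(y x*)` (antilinear in the first variable, as always
in Mathlib; it is denoted `<y, x>` when scalar products are linear in the first variable). -/
instance preCore : InnerProductSpace.Core ℂ T.Pre where
  inner x y := T.τ (star x.val * y.val)
  conj_inner_symm x y := by
    have h := T.map_star (star y.val * x.val)
    rw [star_mul, star_star] at h
    exact h.symm
  re_inner_nonneg x := T.nonneg x.val
  add_left x y z := by
    change T.τ (star (x.val + y.val) * z.val) = _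
    rw [star_add, add_mul, _root_.map_add]
  smul_left x y r := by
    change T.τ (star (r • x.val) * y.val) = _
    rw [star_smul, smul_mul_assoc, _root_.map_smul]
    rfl
  definite x h := T.definite x.val h

instance : NormedAddCommGroup T.Pre :=
  @InnerProductSpace.Core.toNormedAddCommGroup ℂ T.Pre _ _ _ T.preCore

instance : InnerProductSpace ℂ T.Pre := InnerProductSpace.ofCore T.preCore.toCore

/-- The standard module `A₂`: the Hilbert space completion of `A`. -/
abbrev L2 : Type u := UniformSpace.Completion T.Pre

lemma norm_pre_sq (x : T.Pre) : ‖x‖ ^ 2 = (T.τ (star x.val * x.val)).re :=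
  (inner_self_eq_norm_sq (𝕜 := ℂ) x).symm

/-- Left multiplication by `a`, as a bounded operator of the pre-Hilbert space `A`. -/
def preLeft (a : A) : T.Pre →L[ℂ] T.Pre :=
  LinearMap.mkContinuousOfExistsBound
    ({ toFun := fun x => a • x
       map_add' := fun x y => smul_add a x y
       map_smul' := fun c x => by
        change a * (c • x.val) = c • (a * x.val)
        exact mul_smul_comm c a x.val } : T.Pre →ₗ[ℂ] T.Pre)
    (by
      obtain ⟨C, hC⟩ := T.bounded a
      refine ⟨|C|, fun x => ?_⟩
      refine abs_le_of_sq_le_sq' ?_ (by positivity) |>.2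
      rw [mul_pow, sq_abs, norm_pre_sq, norm_pre_sq]
      exact hC x.val)

lemma preLeft_apply (a : A) (x : T.Pre) : T.preLeft a x = a • x := rfl

/-- Left multiplication by `a`, as a bounded operator of `A₂`. -/
def left (a : A) : T.L2 →L[ℂ] T.L2 := (T.preLeft a).completion

lemma left_coe (a : A) (x : T.Pre) : T.left a (x : T.L2) = ((a • x : T.Pre) : T.L2) := by
  simp [left, preLeft_apply]

instance : SMul A T.L2 := ⟨fun a x => T.left a x⟩

lemma smul_def (a : A) (x : T.L2) : a • x = T.left a x := rfl

lemma ext_L2 {f g : T.L2 →L[ℂ] T.L2} (h : ∀ x : T.Pre, f (x : T.L2) = g (x : T.L2)) : f = g := by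
  ext x
  induction x using UniformSpace.Completion.induction_on with
  | hp => exact isClosed_eq f.continuous g.continuous
  | ih x => exact h x

lemma left_one : T.left (1 : A) = ContinuousLinearMap.id ℂ T.L2 :=
  T.ext_L2 fun x => by rw [left_coe, one_smul]; rfl

lemma left_mul (a b : A) : T.left (a * b) = (T.left a).comp (T.left b) :=
  T.ext_L2 fun x => by
    rw [left_coe, ContinuousLinearMap.comp_apply, left_coe, left_coe, mul_smul]

lemma left_add (a b : A) : T.left (a + b) = T.left a + T.left b :=
  T.ext_L2 fun x => by
    rw [left_coe, add_apply, left_coe, left_coe, add_smul,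
      UniformSpace.Completion.coe_add]

lemma left_zero : T.left (0 : A) = 0 :=
  T.ext_L2 fun x => by
    rw [left_coe, zero_smul]; rfl

instance : Module A T.L2 where
  one_smul x := by rw [smul_def, left_one]; rfl
  mul_smul a b x := by rw [smul_def, left_mul]; rfl
  smul_zero a := by rw [smul_def, map_zero]
  smul_add a x y := by rw [smul_def, _root_.map_add]; rfl
  add_smul a b x := by rw [smul_def, left_add]; rfl
  zero_smul x := by rw [smul_def, left_zero]; rfl

/-- The underlying Hilbert space of `A₂ ⊗̂ H`, `H` being the Hilbert space with an orthonormal basis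
indexed by `ι`: the square-summable families of elements of `A₂`. -/
abbrev StdPow (ι : Type v) : Type max u v := lp (fun _ : ι => T.L2) 2

lemma memlp_smul {ι : Type v} (a : A) (f : T.StdPow ι) :
    Memℓp (fun i => a • (f : ∀ _ : ι, T.L2) i) 2 := by
  have hf := (memℓp_gen_iff (p := 2) (by norm_num)).1 (lp.memℓp f)
  refine (memℓp_gen_iff (p := 2) (by norm_num)).2 ?_
  refine Summable.of_nonneg_of_le (fun i => by positivity) (fun i => ?_)
    (hf.mul_left (‖T.left a‖ ^ (2 : ENNReal).toReal))
  rw [← Real.mul_rpow (norm_nonneg _) (norm_nonneg _)]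
  exact Real.rpow_le_rpow (norm_nonneg _) ((T.left a).le_opNorm _) (by norm_num)

/-- `A` acts on `A₂ ⊗̂ H` through `A₂`, that is to say coordinatewise. -/
instance {ι : Type v} : SMul A (T.StdPow ι) := ⟨fun a f => ⟨_, T.memlp_smul a f⟩⟩

lemma stdPow_smul_apply {ι : Type v} (a : A) (f : T.StdPow ι) (i : ι) :
    (a • f : T.StdPow ι) i = a • f i := rfl

instance {ι : Type v} : Module A (T.StdPow ι) where
  one_smul f := by ext i; simp [stdPow_smul_apply]
  mul_smul a b f := by ext i; simp [stdPow_smul_apply, mul_smul]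
  smul_zero a := by ext i; simp [stdPow_smul_apply]
  smul_add a f g := by ext i; simp [stdPow_smul_apply]
  add_smul a b f := by ext i; simp [stdPow_smul_apply, add_smul]
  zero_smul f := by ext i; simp [stdPow_smul_apply]

lemma norm_stdPow_smul_le {ι : Type v} (a : A) (f : T.StdPow ι) :
    ‖a • f‖ ≤ ‖T.left a‖ * ‖f‖ := by
  refine lp.norm_le_of_forall_sum_le (p := 2) (by norm_num) (by positivity) fun s => ?_
  rw [Real.mul_rpow (norm_nonneg _) (norm_nonneg _)]
  refine le_trans ?_ (mul_le_mul_of_nonneg_left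
    (lp.sum_rpow_le_norm_rpow (p := 2) (by norm_num) f s) (by positivity))
  rw [Finset.mul_sum]
  refine Finset.sum_le_sum fun i _ => ?_
  rw [← Real.mul_rpow (norm_nonneg _) (norm_nonneg _), stdPow_smul_apply]
  exact Real.rpow_le_rpow (norm_nonneg _) ((T.left a).le_opNorm _) (by norm_num)

/-- The `A`-module `W` embeds isometrically in `A₂ ⊗̂ H`, `H` having an orthonormal basis
indexed by `ι`. -/
def EmbedsIn (ι : Type v) (W : Type*) [NormedAddCommGroup W] [Module A W] : Prop :=
  ∃ J : W →ₗ[A] T.StdPow ι, ∀ x, ‖J x‖ = ‖x‖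

/-- `W` is of finite type: it embeds isometrically in some `A₂ ⊗ ℂⁿ`. -/
def IsFiniteType (W : Type*) [NormedAddCommGroup W] [Module A W] : Prop :=
  ∃ n : ℕ, T.EmbedsIn (Fin n) W

end TracialAlgebra

/-- Positive elements of a `*`-algebra: the self-adjoint elements of the form `b b*`. -/
def IsPositiveElt (a : A) : Prop := IsSelfAdjoint a ∧ ∃ b : A, a = b * star b

variable (A) in
/-- Finite von Neumann algebras with a trace `τ` normalised by `τ(1) = 1`. -/
structure FiniteVNA extends TracialAlgebra A where
  /-- The standard module is separable. -/
  separable : TopologicalSpace.SeparableSpace toTracialAlgebra.L2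
  /-- The image of `A` in the bounded operators of `A₂` is closed in the strong operator topology
  (the topology of pointwise convergence). -/
  closed : IsClosed {S : toTracialAlgebra.L2 →Lₚₜ[ℂ] toTracialAlgebra.L2 |
    ∃ a : A, ∀ x, S x = a • x}
  /-- The trace is normal: if `a` is the supremum of an increasing sequence `s`,
  then `τ a` is the supremum of the `τ (s n)`. -/
  normal : ∀ (s : ℕ → A) (a : A), (∀ n, IsSelfAdjoint (s n)) → IsSelfAdjoint a →
    (∀ n, IsPositiveElt (s (n + 1) - s n)) →
    (∀ n, IsPositiveElt (a - s n)) →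
    (∀ b, IsSelfAdjoint b → (∀ n, IsPositiveElt (b - s n)) → IsPositiveElt (b - a)) →
    IsLUB (Set.range fun n => (τ (s n)).re) (τ a).re

/-- Projective Hilbert `A`-modules. -/
structure HilbMod (T : FiniteVNA A) where
  carrier : Type v
  [normed : NormedAddCommGroup carrier]
  [innerProduct : InnerProductSpace ℂ carrier]
  [complete : CompleteSpace carrier]
  [module : Module A carrier]
  [tower : IsScalarTower ℂ A carrier]
  inner_smul : ∀ (a : A) (x y : carrier), inner ℂ (a • x) y = inner ℂ x (star a • y)
  projective : ∃ ι : Type v, T.EmbedsIn ι carrier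

variable {T : FiniteVNA A}

namespace HilbMod

instance : CoeSort (HilbMod.{u, v} T) (Type v) := ⟨HilbMod.carrier⟩

attribute [instance] HilbMod.normed HilbMod.innerProduct HilbMod.complete HilbMod.module
  HilbMod.tower

instance (W : HilbMod.{u, v} T) : ContinuousConstSMul A W := by
  obtain ⟨ι, J, hJ⟩ := W.projective
  refine ⟨fun a => ?_⟩
  let f : W →+ W := ⟨⟨fun x => a • x, smul_zero a⟩, smul_add a⟩
  refine AddMonoidHomClass.continuous_of_bound f ‖T.left a‖ fun x => ?_
  change ‖a • x‖ ≤ _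
  rw [← hJ, ← hJ x, map_smul]
  exact T.norm_stdPow_smul_le a _

end HilbMod

/-- An element `φ` of `L_A(V, W)` is `A`-compact if it is the limit, in operator norm, of a sequence
`ψ n` in `L_A(V, W)` such that the closure of the image of each `ψ n` is of finite type. -/
def IsACompact {V W : HilbMod.{u, v} T} (φ : V →L[A] W) : Prop :=
  ∃ ψ : ℕ → V →L[A] W,
    (∀ n, T.IsFiniteType (LinearMap.range (ψ n : V →ₗ[A] W)).topologicalClosure) ∧
    Tendsto (fun n => (ψ n).restrictScalars ℂ) atTop (𝓝 (φ.restrictScalars ℂ))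

variable (T) in
/-- Finitely generated projective Hilbert `A`-modules. -/
structure FGHilbMod extends HilbMod.{u, v} T where
  fg : T.IsFiniteType carrier

/-- The category of finitely generated projective Hilbert `A`-modules; its morphisms are
the continuous `A`-linear maps. -/
instance : Category (FGHilbMod.{u, v} T) where
  Hom V W := V.toHilbMod →L[A] W.toHilbMod
  id V := ContinuousLinearMap.id A V.toHilbMod
  comp f g := ContinuousLinearMap.comp g f

instance : Limits.HasZeroMorphisms (FGHilbMod.{u, v} T) where
  zero V W := ⟨(0 : V.toHilbMod →L[A] W.toHilbMod)⟩
  comp_zero f _ := ContinuousLinearMap.zero_comp f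
  zero_comp _ _ _ g := ContinuousLinearMap.comp_zero g

variable (T) in
/-- Representatives of montelian modules: premontelian modules `(W(t))_{0 < t ≤ t₀}` for some
`t₀ > 0`. Here `mod t` and `ρ t t'` carry information only for `0 < t' ≤ t ≤ t₀`. -/
structure MontMod where
  t₀ : ℝ
  t₀_pos : 0 < t₀
  mod : ℝ → HilbMod.{u, v} T
  ρ : ∀ t t' : ℝ, mod t →L[A] mod t'
  ρ_self : ∀ t, 0 < t → t ≤ t₀ → ρ t t = ContinuousLinearMap.id A (mod t)
  ρ_comp : ∀ t t' t'', 0 < t'' → t'' ≤ t' → t' ≤ t → t ≤ t₀ →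
    ρ t t'' = (ρ t' t'').comp (ρ t t')
  ρ_compact : ∀ t t', 0 < t' → t' < t → t ≤ t₀ → IsACompact (ρ t t')

namespace MontMod

/-- Representatives of morphisms of montelian modules: families `φ(t) : V(t) → W(t)`
that commute with the maps `ρ` for all sufficiently small indices. -/
structure PreHom (V W : MontMod.{u, v} T) where
  app : ∀ t : ℝ, V.mod t →L[A] W.mod t
  comm : ∃ s : ℝ, 0 < s ∧ ∀ t t', 0 < t' → t' ≤ t → t ≤ s →
    (app t').comp (V.ρ t t') = (W.ρ t t').comp (app t)

/-- Two families represent the same morphism if they agree for all sufficiently small `t > 0`. -/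
instance preHomSetoid (V W : MontMod.{u, v} T) : Setoid (PreHom V W) where
  r φ ψ := ∀ᶠ t in 𝓝[>] (0 : ℝ), φ.app t = ψ.app t
  iseqv :=
    { refl := fun _ => Eventually.of_forall fun _ => rfl
      symm := fun h => h.mono fun _ => Eq.symm
      trans := fun h h' => by filter_upwards [h, h'] with t a b using a.trans b }

/-- Morphisms of montelian modules. -/
def Hom (V W : MontMod.{u, v} T) : Type v := Quotient (preHomSetoid V W)

/-- A representative of a morphism. -/
def Hom.rep {V W : MontMod.{u, v} T} (φ : Hom V W) : PreHom V W := Quotient.out φ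

def PreHom.id (V : MontMod.{u, v} T) : PreHom V V where
  app t := ContinuousLinearMap.id A (V.mod t)
  comm := ⟨1, one_pos, fun _ _ _ _ _ => rfl⟩

def PreHom.comp {U V W : MontMod.{u, v} T} (φ : PreHom U V) (ψ : PreHom V W) : PreHom U W where
  app t := (ψ.app t).comp (φ.app t)
  comm := by
    obtain ⟨s, hs, h⟩ := φ.comm
    obtain ⟨s', hs', h'⟩ := ψ.comm
    refine ⟨min s s', lt_min hs hs', fun t t' ht' htt ht => ?_⟩
    rw [ContinuousLinearMap.comp_assoc, h t t' ht' htt (ht.trans (min_le_left _ _)),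
      ← ContinuousLinearMap.comp_assoc, h' t t' ht' htt (ht.trans (min_le_right _ _)),
      ContinuousLinearMap.comp_assoc]

def PreHom.zero (V W : MontMod.{u, v} T) : PreHom V W where
  app _ := 0
  comm := ⟨1, one_pos, fun _ _ _ _ _ => by simp⟩

/-- The category of montelian modules. Montelian modules that are represented by premontelian
modules agreeing for small `t` are identified by the morphism represented by the identity. -/
instance : Category (MontMod.{u, v} T) where
  Hom := Hom
  id V := Quotient.mk _ (PreHom.id V)
  comp := Quotient.map₂ PreHom.comp fun φ φ' h ψ ψ' h' => by
    filter_upwards [h, h'] with t a b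
    simp only [PreHom.comp, a, b]
  id_comp φ := by induction φ using Quotient.inductionOn; rfl
  comp_id φ := by induction φ using Quotient.inductionOn; rfl
  assoc φ ψ χ := by
    induction φ using Quotient.inductionOn
    induction ψ using Quotient.inductionOn
    induction χ using Quotient.inductionOn
    rfl

instance : Limits.HasZeroMorphisms (MontMod.{u, v} T) where
  zero V W := ⟨Quotient.mk _ (PreHom.zero V W)⟩
  comp_zero φ W := by
    induction φ using Quotient.inductionOn with | h φ
    exact Quotient.sound (Eventually.of_forall fun t => ContinuousLinearMap.zero_comp _)
  zero_comp U V W φ := by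
    induction φ using Quotient.inductionOn with | h φ
    exact Quotient.sound (Eventually.of_forall fun t => ContinuousLinearMap.comp_zero _)

/-- The projective limit `W_*(t)` of the `W(r)`, `0 < r < t`. -/
def lim (W : MontMod.{u, v} T) (t : ℝ) : Submodule A (∀ r : Set.Ioo (0 : ℝ) t, W.mod r) where
  carrier := {z | ∀ r r' : Set.Ioo (0 : ℝ) t, (r' : ℝ) ≤ r → W.ρ r r' (z r) = z r'}
  add_mem' hx hy r r' h := by
    rw [Pi.add_apply, map_add, hx r r' h, hy r r' h, Pi.add_apply]
  zero_mem' r r' _ := by rw [Pi.zero_apply, map_zero, Pi.zero_apply]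
  smul_mem' a x hx r r' h := by
    rw [Pi.smul_apply, map_smul, hx r r' h, Pi.smul_apply]

instance (W : MontMod.{u, v} T) (t : ℝ) : AddCommGroup (W.lim t) :=
  Submodule.addCommGroup (W.lim t)

/-- The index `r < t'`, seen as an index `r < t` when `t' ≤ t`. -/
def incl {t t' : ℝ} (h : t' ≤ t) (r : Set.Ioo (0 : ℝ) t') : Set.Ioo (0 : ℝ) t :=
  ⟨r, r.2.1, r.2.2.trans_le h⟩

/-- The restriction map `W_*(t) → W_*(t')` for `t' ≤ t`. -/
def res (W : MontMod.{u, v} T) {t t' : ℝ} (h : t' ≤ t) : W.lim t →ₗ[A] W.lim t' where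
  toFun z := ⟨fun r => z.1 (incl h r), fun r r' hr => z.2 (incl h r) (incl h r') hr⟩
  map_add' _ _ := rfl
  map_smul' _ _ := rfl

/-- The map induced in each degree `r < t` by a representative of a morphism, defined on `V_*(t)`.
For `t` small it takes its values in `W_*(t)`. -/
def PreHom.star {V W : MontMod.{u, v} T} (φ : PreHom V W) (t : ℝ) :
    V.lim t →ₗ[A] (∀ r : Set.Ioo (0 : ℝ) t, W.mod r) where
  toFun z r := φ.app r (z.1 r)
  map_add' x y := by ext r; exact map_add (φ.app r) (x.1 r) (y.1 r)
  map_smul' a x := by ext r; exact map_smul (φ.app r) a (x.1 r)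

/-- `φ` commutes with the maps `ρ` on `]0, s]`. -/
def PreHom.CommOn {V W : MontMod.{u, v} T} (φ : PreHom V W) (s : ℝ) : Prop :=
  ∀ t t', 0 < t' → t' ≤ t → t ≤ s → (φ.app t').comp (V.ρ t t') = (W.ρ t t').comp (φ.app t)

lemma PreHom.star_mem {V W : MontMod.{u, v} T} (φ : PreHom V W) {s t : ℝ} (h : φ.CommOn s)
    (ht : t ≤ s) (z : V.lim t) : φ.star t z ∈ W.lim t := by
  intro r r' hr
  have e := h r r' r'.2.1 hr (r.2.2.le.trans ht)
  have e' := DFunLike.congr_fun e (z.1 r)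
  change φ.app r' (V.ρ r r' (z.1 r)) = W.ρ r r' (φ.app r (z.1 r)) at e'
  change W.ρ r r' (φ.app r (z.1 r)) = φ.app r' (z.1 r')
  rw [← e', z.2 r r' hr]

variable (K L : CochainComplex (MontMod.{u, v} T) ℤ)

/-- A representative of a differential of a complex of montelian modules. -/
abbrev dRep (i j : ℤ) : PreHom (K.X i) (K.X j) := Hom.rep (K.d i j)

/-- A representative of a component of a morphism of complexes of montelian modules. -/
abbrev fRep {K L : CochainComplex (MontMod.{u, v} T) ℤ} (σ : K ⟶ L) (i : ℤ) :
    PreHom (K.X i) (L.X i) := Hom.rep (σ.f i)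

/-- The cycles `Z^i_*(t, K)`. -/
def cyclesStar (i : ℤ) (t : ℝ) : Submodule A ((K.X i).lim t) :=
  LinearMap.ker ((dRep K i (i + 1)).star t)

instance (i : ℤ) (t : ℝ) : AddCommGroup (cyclesStar K i t) :=
  Submodule.addCommGroup (cyclesStar K i t)

/-- The boundaries `B^i_*(t, K)`. -/
def bdryStar (i : ℤ) (t : ℝ) : Submodule A ((K.X i).lim t) :=
  (LinearMap.range ((dRep K (i - 1) i).star t)).comap ((K.X i).lim t).subtype

/-- The cohomology `H^i_*(t, K) = Z^i_*(t, K) / B^i_*(t, K)`. (One divides by the intersection of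
`B^i_*` with `Z^i_*`, which is `B^i_*` for all sufficiently small `t`.) -/
abbrev cohomStar (i : ℤ) (t : ℝ) : Type _ :=
  cyclesStar K i t ⧸ (bdryStar K i t).submoduleOf (cyclesStar K i t)

variable {K L}

/-- On `]0, s]`, the chosen representatives of `σ` commute with the maps `ρ` and with the
differentials around degree `i`. This is true for all sufficiently small `s > 0`. -/
structure ChainOn (σ : K ⟶ L) (i : ℤ) (s : ℝ) : Prop where
  comm : (fRep σ i).CommOn s
  comm_prev : (fRep σ (i - 1)).CommOn s
  d_next : ∀ r, 0 < r → r ≤ s → ((dRep L i (i + 1)).app r).comp ((fRep σ i).app r) =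
    ((fRep σ (i + 1)).app r).comp ((dRep K i (i + 1)).app r)
  d_prev : ∀ r, 0 < r → r ≤ s → ((dRep L (i - 1) i).app r).comp ((fRep σ (i - 1)).app r) =
    ((fRep σ i).app r).comp ((dRep K (i - 1) i).app r)

/-- The map `Z^i_*(t, K) → Z^i_*(t', L)` induced by `σ`. -/
def cyclesMap {σ : K ⟶ L} {i : ℤ} {s t t' : ℝ} (h : ChainOn σ i s) (htt : t' ≤ t) (hts : t ≤ s) :
    cyclesStar K i t →ₗ[A] cyclesStar L i t' :=
  LinearMap.restrict
    (((L.X i).res htt).comp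
      (((fRep σ i).star t).codRestrict ((L.X i).lim t) ((fRep σ i).star_mem h.comm hts)))
    (by
      intro z hz
      change (dRep L i (i + 1)).star t' _ = 0
      funext r
      have e := DFunLike.congr_fun (h.d_next r r.2.1 (r.2.2.le.trans (htt.trans hts)))
        (z.1 (incl htt r))
      have hz' : (dRep K i (i + 1)).app r (z.1 (incl htt r)) = 0 := congrFun hz (incl htt r)
      change _ = (fRep σ (i + 1)).app r ((dRep K i (i + 1)).app r (z.1 (incl htt r))) at e
      rw [hz', map_zero] at e
      exact e)

/-- The map `σ_t^{t'} : H^i_*(t, K) → H^i_*(t', L)` induced by `σ`, for `t' ≤ t`. -/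
def cohomMap {σ : K ⟶ L} {i : ℤ} {s t t' : ℝ} (h : ChainOn σ i s) (htt : t' ≤ t) (hts : t ≤ s) :
    cohomStar K i t →ₗ[A] cohomStar L i t' :=
  Submodule.mapQ _ _ (cyclesMap h htt hts) (by
    rintro z ⟨y, hy⟩
    refine ⟨(K.X (i - 1)).res htt y |> fun y' =>
      ⟨(fRep σ (i - 1)).star t' y', (fRep σ (i - 1)).star_mem h.comm_prev (htt.trans hts) y'⟩, ?_⟩
    funext r
    have e := DFunLike.congr_fun (h.d_prev r r.2.1 (r.2.2.le.trans (htt.trans hts)))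
      (y.1 (incl htt r))
    have hy' : (dRep K (i - 1) i).app r (y.1 (incl htt r)) = z.1.1 (incl htt r) :=
      congrFun hy (incl htt r)
    change _ = (fRep σ i).app r ((dRep K (i - 1) i).app r (y.1 (incl htt r))) at e
    rw [hy'] at e
    exact e)

/-- `σ` is a qi-morphism of order `q`: for all sufficiently small `t' ≤ t`, the maps
`σ_t^{t'} : H^i_*(t, K) → H^i_*(t', L)` are isomorphisms for `i > q` and a surjection
for `i = q`. -/
def IsQiOfOrder (σ : K ⟶ L) (q : ℤ) : Prop :=
  (∀ i, q < i → ∃ s : ℝ, 0 < s ∧ ∃ h : ChainOn σ i s,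
    ∀ t t' (_ : 0 < t') (htt : t' ≤ t) (hts : t ≤ s),
      Function.Bijective (cohomMap h htt hts)) ∧
  (∃ s : ℝ, 0 < s ∧ ∃ h : ChainOn σ q s,
    ∀ t t' (_ : 0 < t') (htt : t' ≤ t) (hts : t ≤ s),
      Function.Surjective (cohomMap h htt hts))

/-- `σ` is a qi-morphism: it is a qi-morphism of every order. -/
def IsQi (σ : K ⟶ L) : Prop := ∀ q : ℤ, IsQiOfOrder σ q

/-- `K` is qhtf: its identity is a qi-morphism. -/
def IsQhtf (K : CochainComplex (MontMod.{u, v} T) ℤ) : Prop := IsQi (𝟙 K)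

end MontMod

lemma TracialAlgebra.IsFiniteType.submodule {S : TracialAlgebra A} {W : Type*}
    [NormedAddCommGroup W] [Module A W] (h : S.IsFiniteType W) (N : Submodule A W) :
    S.IsFiniteType N := by
  obtain ⟨n, J, hJ⟩ := h
  exact ⟨n, J.comp N.subtype, fun x => hJ x⟩

/-- A finitely generated projective Hilbert module `L`, seen as the montelian module `W(t) = L`
with `ρ = id`. -/
def FGHilbMod.const (L : FGHilbMod.{u, v} T) : MontMod.{u, v} T where
  t₀ := 1
  t₀_pos := one_pos
  mod _ := L.toHilbMod
  ρ _ _ := ContinuousLinearMap.id A L.toHilbMod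
  ρ_self _ _ _ := rfl
  ρ_comp _ _ _ _ _ _ _ := rfl
  ρ_compact _ _ _ _ _ :=
    ⟨fun _ => ContinuousLinearMap.id A L.toHilbMod, fun _ => L.fg.submodule _, tendsto_const_nhds⟩

variable (T) in
/-- The functor from finitely generated projective Hilbert modules to montelian modules. -/
def constFunctor : FGHilbMod.{u, v} T ⥤ MontMod.{u, v} T where
  obj := FGHilbMod.const
  map f := Quotient.mk _ ⟨fun _ => f, 1, one_pos, fun _ _ _ _ _ => rfl⟩

instance : (constFunctor.{u, v} T).PreservesZeroMorphisms where
  map_zero _ _ := rfl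

/-- A complex of finitely generated projective Hilbert modules, seen as a complex of
montelian modules. -/
abbrev toMont (P : CochainComplex (FGHilbMod.{u, v} T) ℤ) : CochainComplex (MontMod.{u, v} T) ℤ :=
  ((constFunctor T).mapHomologicalComplex (ComplexShape.up ℤ)).obj P

/-- The morphism of complexes of montelian modules given by a morphism of complexes of finitely
generated projective Hilbert modules. -/
abbrev toMontMap {P Q : CochainComplex (FGHilbMod.{u, v} T) ℤ} (f : P ⟶ Q) :
    toMont P ⟶ toMont Q :=
  ((constFunctor T).mapHomologicalComplex (ComplexShape.up ℤ)).map f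

end Standard

section Bounded

variable {C : Type*} [Category C] [Limits.HasZeroMorphisms C]

/-- The complex `K` is bounded above. -/
def IsBoundedAbove (K : CochainComplex C ℤ) : Prop :=
  ∃ b : ℤ, ∀ i, b < i → Limits.IsZero (K.X i)

/-- The complex `K` is finite. -/
def IsFiniteComplex (K : CochainComplex C ℤ) : Prop :=
  ∃ a b : ℤ, ∀ i, (i < a ∨ b < i) → Limits.IsZero (K.X i)

end Bounded

end

/-!
The complex `P` is built by descending induction on the degree, so that the cone of `P → F` becomes
acyclic; then `P → F` is a qi-morphism (`MontMod.isQi_of_cone_exact`).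

Suppose that `P` is known in degrees above `i`, let `Z` be the cycles of `P^{i+1}` and let
`σ : Z → F^{i+1}` be the restriction of `P^{i+1} → F^{i+1}`. The cycles of degree `i` of the cone
are the pairs `(f, x)`, `f ∈ F^i_*(t)`, `x ∈ Z`, such that `d f = σ x`. As `F` is qhtf, such pairs
extend to larger indices modulo the boundaries of `F`: injectivity in degree `i + 1` gives some pair
with the same `x` at the larger index, and surjectivity in degree `i` corrects its first component
(`MontMod.IsQhtf.eventually_extend_cone`). On the other hand the restriction from a larger index is
approximated in norm by morphisms that factor through finitely generated modules. This is the
situation of Schwartz' finiteness theorem, in the form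
`HilbMod.IsApproximable.exists_fg_of_forall_exists`. Write `p(e) = v(e) + (boundary)` for the
decompositions of cycles `p(e)` into the restriction `v(e)` of a cycle at a larger index and a
boundary; the triples `e` form a Hilbert module, on which `p` is surjective and `v` approximable. If
`v'` is close to `v` and factors through a finitely generated module, `p - v + v'` is still
surjective, so that boundaries and the image of `v'` together exhaust the cycles. The argument only
involves Hilbert modules at three fixed indices instead of projective limits, and no polar
decomposition is needed, because the finitely generated module need not embed in the cycles. Hence a
finitely generated `L` generates the cohomology of degree `i` of the cone
(`MontMod.IsQhtf.exists_fg_generating_cone`).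

To factor a given `φ : Q → F`, one takes `P^i = Q^i ⊕ L`, and `Q → P` is the inclusion
(`MontMod.Stage.exists_isLink`). In the degrees where `F` and `Q` vanish, one takes instead for
`P^i` the cycles of `P^{i+1}` (`MontMod.Stage.exists_isLink_of_vanishes`); in the next lower degree
there are no cycles left, and so `P` is finite when `F` and `Q` are. The existence of `P → F` alone
is the case `Q = 0`.
-/

universe w

noncomputable section

/-! ### Perturbation of surjections -/

/-- A surjection of Banach spaces remains surjective after a small perturbation. -/
theorem ContinuousLinearMap.exists_surjective_add_of_norm_lt {E F : Type*}
    [NormedAddCommGroup E] [NormedSpace ℂ E] [CompleteSpace E]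
    [NormedAddCommGroup F] [NormedSpace ℂ F] [CompleteSpace F]
    (p : E →L[ℂ] F) (hp : Function.Surjective p) :
    ∃ δ : ℝ, 0 < δ ∧ ∀ u : E →L[ℂ] F, ‖u‖ < δ → Function.Surjective fun e => p e + u e := by
  let R := p.nonlinearRightInverseOfSurjective (LinearMap.range_eq_top.2 hp)
  have hR : 0 < R.nnnorm := p.nonlinearRightInverseOfSurjective_nnnorm_pos _
  refine ⟨(R.nnnorm : ℝ)⁻¹, by positivity, fun u hu => ?_⟩
  have happ : ApproximatesLinearOn (fun e => p e + u e) p Set.univ ‖u‖₊ := fun x _ y _ => by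
    have e : p x + u x - (p y + u y) - p (x - y) = u (x - y) := by
      rw [map_sub, map_sub]; abel
    rw [e]
    exact u.le_opNorm _
  intro y
  have hε : 0 < (R.nnnorm : ℝ)⁻¹ - ‖u‖ := sub_pos.2 hu
  obtain ⟨x, -, hx⟩ := happ.surjOn_closedBall_of_nonlinearRightInverse R
    (ε := ‖y‖ / ((R.nnnorm : ℝ)⁻¹ - ‖u‖)) (b := 0) (by positivity) (Set.subset_univ _)
    (show y ∈ _ by
      rw [mem_closedBall_iff_norm]
      simp [mul_div_cancel₀ _ hε.ne'])
  exact ⟨x, hx⟩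

/-! ### Descending recursion -/

/-- Descending recursion on `ℤ`: above `b` the objects are given by `top`, and below they are
chosen one after the other. -/
theorem exists_descending_family {S : ℤ → Type*} (R : ∀ i, S i → S (i + 1) → Prop) (b : ℤ)
    (top : ∀ i, b < i → S i) (htop : ∀ i (hi : b < i), R i (top i hi) (top (i + 1) (by omega)))
    (step : ∀ i (s' : S (i + 1)), ∃ s, R i s s') :
    ∃ s : ∀ i, S i, (∀ i, R i (s i) (s (i + 1))) ∧ ∀ i (hi : b < i), s i = top i hi := by
  choose f hf using step
  -- `below n` is the family in degrees above `b - n`.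
  let next (n : ℕ) (s : ∀ i, b - n < i → S i) (i : ℤ) (_ : b - (n + 1 : ℕ) < i) : S i :=
    if h : b - n < i then s i h else f i (s (i + 1) (by push_cast at *; omega))
  let below (n : ℕ) : ∀ i, b - n < i → S i :=
    Nat.rec (fun i hi => top i (by simpa using hi)) next n
  have hsucc : ∀ (n : ℕ) i (h : b - n < i) (h' : b - (n + 1 : ℕ) < i),
      below (n + 1) i h' = below n i h := fun n i h h' => dif_pos h
  have hle : ∀ (m n : ℕ) i (h : b - n < i) (h' : b - (n + m : ℕ) < i),
      below (n + m) i h' = below n i h := by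
    intro m n i h
    induction m with
    | zero => exact fun _ => rfl
    | succ m ih => exact fun h' => (hsucc (n + m) i (by push_cast; omega) h').trans (ih _)
  let s (i : ℤ) : S i := below (b + 1 - i).toNat i (by omega)
  have hs : ∀ (n : ℕ) i (h : b - n < i), below n i h = s i := fun n i h => by
    obtain ⟨m, rfl⟩ : ∃ m, n = (b + 1 - i).toNat + m := ⟨n - (b + 1 - i).toNat, by omega⟩
    exact hle m _ i _ h
  have hs_top : ∀ i (hi : b < i), s i = top i hi := fun i hi =>
    (hs 0 i (by simpa using hi)).symm
  refine ⟨s, fun i => ?_, hs_top⟩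
  by_cases hi : b < i
  · rw [hs_top i hi, hs_top (i + 1) (by omega)]
    exact htop i hi
  · have e : s i = f i (s (i + 1)) := by
      rw [← hs ((b - i).toNat + 1) i (by omega), ← hs (b - i).toNat (i + 1) (by omega)]
      exact dif_neg (by omega)
    rw [e]
    exact hf i _

section Modules

/-! ### Embeddings in the standard modules -/

variable {A : Type u} [Ring A] [Algebra ℂ A] [StarRing A] [StarModule ℂ A]

namespace TracialAlgebra

variable {S : TracialAlgebra A}

lemma StdPow.hasSum_norm_sq {ι : Type v} (f : S.StdPow ι) :
    HasSum (fun i => ‖f i‖ ^ 2) (‖f‖ ^ 2) := by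
  simpa using lp.hasSum_norm (p := 2) (by norm_num) f

/-- An isometric embedding in `A₂ ⊗̂ H` is a family of maps to `A₂`, its coordinates. -/
theorem embedsIn_iff {ι : Type v} {W : Type*} [NormedAddCommGroup W] [Module A W] :
    S.EmbedsIn ι W ↔
      ∃ J : ι → W →ₗ[A] S.L2, ∀ x, HasSum (fun i => ‖J i x‖ ^ 2) (‖x‖ ^ 2) := by
  constructor
  · rintro ⟨J, hJ⟩
    refine ⟨fun i => ⟨⟨fun x => J x i, fun x y => by rw [map_add]; rfl⟩,
      fun a x => congrArg (fun f : S.StdPow ι => f i) (map_smul J a x)⟩, fun x => ?_⟩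
    rw [← hJ x]
    exact StdPow.hasSum_norm_sq (J x)
  · rintro ⟨J, hJ⟩
    have hmem : ∀ x, Memℓp (fun i => J i x) 2 := fun x =>
      (memℓp_gen_iff (p := 2) (by norm_num)).2 (by simpa using (hJ x).summable)
    refine ⟨⟨⟨fun x => ⟨fun i => J i x, hmem x⟩, fun x y => ?_⟩, fun a x => ?_⟩, fun x => ?_⟩
    · ext i; exact map_add (J i) x y
    · ext i; exact map_smul (J i) a x
    · have h := StdPow.hasSum_norm_sq (S := S) (⟨fun i => J i x, hmem x⟩ : S.StdPow ι)
      exact (pow_left_inj₀ (norm_nonneg _) (norm_nonneg _) two_ne_zero).1 (h.unique (hJ x))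

theorem EmbedsIn.reindex {ι : Type v} {κ : Type w} (e : κ ≃ ι) {W : Type*} [NormedAddCommGroup W]
    [Module A W] (h : S.EmbedsIn ι W) : S.EmbedsIn κ W := by
  rw [embedsIn_iff] at h ⊢
  obtain ⟨J, hJ⟩ := h
  exact ⟨fun k => J (e k), fun x => e.hasSum_iff.2 (hJ x)⟩

theorem EmbedsIn.submodule {ι : Type v} {W : Type*} [NormedAddCommGroup W] [Module A W]
    (h : S.EmbedsIn ι W) (N : Submodule A W) : S.EmbedsIn ι N := by
  obtain ⟨J, hJ⟩ := h
  exact ⟨J.comp N.subtype, fun x => hJ x⟩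

theorem EmbedsIn.prod {ι : Type v} {κ : Type w} {V W : Type*} [NormedAddCommGroup V] [Module A V]
    [NormedAddCommGroup W] [Module A W] (hV : S.EmbedsIn ι V) (hW : S.EmbedsIn κ W) :
    S.EmbedsIn (ι ⊕ κ) (WithLp 2 (V × W)) := by
  rw [embedsIn_iff] at *
  obtain ⟨J, hJ⟩ := hV
  obtain ⟨J', hJ'⟩ := hW
  refine ⟨Sum.elim
    (fun i => (J i).comp ((LinearMap.fst A V W).comp (WithLp.linearEquiv 2 A (V × W)).toLinearMap))
    (fun k => (J' k).comp
      ((LinearMap.snd A V W).comp (WithLp.linearEquiv 2 A (V × W)).toLinearMap)), fun x => ?_⟩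
  rw [WithLp.prod_norm_sq_eq_of_L2]
  exact (hJ x.fst).sum (hJ' x.snd)

end TracialAlgebra

/-! ### Closed submodules and direct sums -/

variable {T : FiniteVNA A}

namespace HilbMod

/-- The scalar product of an `A`-submodule; Mathlib provides it only for `ℂ`-submodules. -/
instance (W : HilbMod.{u, v} T) (K : Submodule A W) : InnerProductSpace ℂ K where
  inner x y := inner ℂ (x : W) (y : W)
  norm_sq_eq_re_inner x := norm_sq_eq_re_inner (𝕜 := ℂ) (x : W)
  conj_inner_symm x y := inner_conj_symm (x : W) (y : W)
  add_left x y z := inner_add_left (x : W) (y : W) (z : W)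
  smul_left x y r := inner_smul_left (x : W) (y : W) r

/-- A closed submodule of a projective Hilbert module. -/
def ofClosed (W : HilbMod.{u, v} T) (K : Submodule A W) (hK : IsClosed (K : Set W)) :
    HilbMod.{u, v} T where
  carrier := K
  complete := hK.completeSpace_coe
  inner_smul a x y := W.inner_smul a x y
  projective := W.projective.imp fun _ h => h.submodule K

/-- The orthogonal direct sum of two projective Hilbert modules. -/
def prod (V W : HilbMod.{u, v} T) : HilbMod.{u, v} T where
  carrier := WithLp 2 (V × W)
  inner_smul a x y := congrArg₂ (· + ·) (V.inner_smul a x.fst y.fst) (W.inner_smul a x.snd y.snd)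
  projective := by
    obtain ⟨ι, h⟩ := V.projective
    obtain ⟨κ, h'⟩ := W.projective
    exact ⟨ι ⊕ κ, h.prod h'⟩

section Constructions

variable (V W : HilbMod.{u, v} T)

/-- The first projection of a direct sum. -/
def fst : V.prod W →L[A] V := WithLp.fstL 2 A V W

/-- The second projection of a direct sum. -/
def snd : V.prod W →L[A] W := WithLp.sndL 2 A V W

variable {V W}

/-- The map to a direct sum with given components. -/
def lift {U : HilbMod.{u, v} T} (f : U →L[A] V) (g : U →L[A] W) : U →L[A] V.prod W :=
  ((WithLp.prodContinuousLinearEquiv 2 A V W).symm : V × W →L[A] WithLp 2 (V × W)).comp (f.prod g)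

/-- The element of a direct sum with given components. -/
def pair (x : V) (y : W) : V.prod W := WithLp.toLp 2 (x, y)

@[simp] lemma fst_pair (x : V) (y : W) : fst V W (pair x y) = x := rfl

@[simp] lemma snd_pair (x : V) (y : W) : snd V W (pair x y) = y := rfl

lemma prod_ext {x y : V.prod W} (h₁ : fst V W x = fst V W y) (h₂ : snd V W x = snd V W y) :
    x = y :=
  WithLp.ofLp_injective 2 (Prod.ext h₁ h₂)

lemma norm_sq_prod (x : V.prod W) : ‖x‖ ^ 2 = ‖fst V W x‖ ^ 2 + ‖snd V W x‖ ^ 2 :=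
  WithLp.prod_norm_sq_eq_of_L2 x

lemma norm_fst_le (x : V.prod W) : ‖fst V W x‖ ≤ ‖x‖ := by
  refine abs_le_of_sq_le_sq' ?_ (norm_nonneg x) |>.2
  rw [norm_sq_prod x]
  exact le_add_of_nonneg_right (by positivity)

lemma norm_pair_sub_pair (x x' : V) (y : W) : ‖pair x y - pair x' y‖ = ‖x - x'‖ := by
  refine (pow_left_inj₀ (norm_nonneg _) (norm_nonneg _) two_ne_zero).1 ?_
  rw [norm_sq_prod, map_sub, map_sub, fst_pair, fst_pair, snd_pair, snd_pair]
  simp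

/-- The inclusion of a closed submodule. -/
def incl (K : Submodule A W) (hK : IsClosed (K : Set W)) : W.ofClosed K hK →L[A] W := K.subtypeL

lemma incl_mem (K : Submodule A W) (hK : IsClosed (K : Set W)) (x : W.ofClosed K hK) :
    incl K hK x ∈ K := x.2

lemma incl_injective (K : Submodule A W) (hK : IsClosed (K : Set W)) :
    Function.Injective (incl K hK) := Subtype.val_injective

lemma exists_incl_eq (K : Submodule A W) (hK : IsClosed (K : Set W)) {x : W} (hx : x ∈ K) :
    ∃ y, incl K hK y = x := ⟨⟨x, hx⟩, rfl⟩

/-- The corestriction of a morphism to a closed submodule. -/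
def corestrict {U : HilbMod.{u, v} T} (K : Submodule A W) (hK : IsClosed (K : Set W))
    (f : U →L[A] W) (h : ∀ x, f x ∈ K) : U →L[A] W.ofClosed K hK := f.codRestrict K h

/-- The orthogonal projection to a closed submodule is a morphism, because the orthogonal
complement of a submodule is a submodule. -/
theorem exists_proj (K : Submodule A W) (hK : IsClosed (K : Set W)) :
    ∃ π : W →L[A] W, (∀ x, π x ∈ K) ∧ (∀ x ∈ K, π x = x) ∧ ∀ x, ‖π x‖ ≤ ‖x‖ := by
  let K' : Submodule ℂ W := K.restrictScalars ℂ
  have : CompleteSpace K' := hK.completeSpace_coe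
  have hmem : ∀ x, K'.starProjection x ∈ K := fun x => K'.starProjection_apply_mem x
  have hsmul : ∀ (a : A) x, K'.starProjection (a • x) = a • K'.starProjection x := fun a x => by
    refine Submodule.eq_starProjection_of_mem_of_inner_eq_zero (K.smul_mem a (hmem x))
      fun y hy => ?_
    rw [← smul_sub, W.inner_smul]
    exact Submodule.starProjection_inner_eq_zero x _ (K.smul_mem (star a) hy)
  exact ⟨⟨⟨⟨K'.starProjection, map_add _⟩, hsmul⟩, K'.starProjection.continuous⟩, hmem,
    fun x hx => (Submodule.starProjection_eq_self_iff (K := K')).2 hx,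
    K'.norm_starProjection_apply_le⟩

end Constructions

end HilbMod

namespace FGHilbMod

/-- A closed submodule of a finitely generated projective Hilbert module. -/
def ofClosed (W : FGHilbMod.{u, v} T) (K : Submodule A W.toHilbMod)
    (hK : IsClosed (K : Set W.toHilbMod)) : FGHilbMod.{u, v} T where
  toHilbMod := W.toHilbMod.ofClosed K hK
  fg := W.fg.submodule K

/-- The orthogonal direct sum of two finitely generated projective Hilbert modules. -/
def prod (V W : FGHilbMod.{u, v} T) : FGHilbMod.{u, v} T where
  toHilbMod := V.toHilbMod.prod W.toHilbMod
  fg := by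
    obtain ⟨m, h⟩ := V.fg
    obtain ⟨n, h'⟩ := W.fg
    exact ⟨m + n, (h.prod h').reindex finSumFinEquiv.symm⟩

end FGHilbMod

/-! ### The finiteness argument -/

namespace HilbMod

variable {V W : HilbMod.{u, v} T}

/-- A morphism is approximable if, up to morphisms of arbitrarily small norm, it factors through
finitely generated projective modules. -/
def IsApproximable (φ : V →L[A] W) : Prop :=
  ∀ ε : ℝ, 0 < ε → ∃ (L : FGHilbMod.{u, v} T) (a : V →L[A] L.toHilbMod) (j : L.toHilbMod →L[A] W),
    ∀ x, ‖j (a x) - φ x‖ ≤ ε * ‖x‖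

theorem _root_.IsACompact.isApproximable {φ : V →L[A] W} (h : IsACompact φ) :
    IsApproximable φ := by
  obtain ⟨ψ, hfg, hlim⟩ := h
  intro ε hε
  obtain ⟨n, hn⟩ := ((Metric.tendsto_nhds.1 hlim) ε hε).exists
  let M := (LinearMap.range (ψ n : V →ₗ[A] W)).topologicalClosure
  have hM : IsClosed (M : Set W) := Submodule.isClosed_topologicalClosure _
  refine ⟨⟨W.ofClosed M hM, hfg n⟩, corestrict M hM (ψ n) fun x =>
    Submodule.le_topologicalClosure _ ⟨x, rfl⟩, incl M hM, fun x => ?_⟩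
  rw [dist_eq_norm] at hn
  exact ((ψ n).restrictScalars ℂ - φ.restrictScalars ℂ).le_of_opNorm_le hn.le x

theorem IsApproximable.prod_id {φ : V →L[A] W} (h : IsApproximable φ) (K : FGHilbMod.{u, v} T) :
    IsApproximable (lift (φ.comp (fst V K.toHilbMod)) (snd V K.toHilbMod)) := by
  intro ε hε
  obtain ⟨L, a, j, hL⟩ := h ε hε
  refine ⟨L.prod K, lift (a.comp (fst V K.toHilbMod)) (snd V K.toHilbMod),
    lift (j.comp (fst L.toHilbMod K.toHilbMod)) (snd L.toHilbMod K.toHilbMod), fun x => ?_⟩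
  change ‖pair (j (a (fst V K.toHilbMod x))) (snd V K.toHilbMod x) -
    pair (φ (fst V K.toHilbMod x)) (snd V K.toHilbMod x)‖ ≤ _
  rw [norm_pair_sub_pair]
  exact (hL _).trans (mul_le_mul_of_nonneg_left (norm_fst_le x) hε.le)

/-- Schwartz' finiteness argument. Let `Z ⊆ V` and `Z' ⊆ W` be closed submodules, and `ρ : V → W` an
approximable morphism that maps `Z` to `Z'`. If modulo the image of `d` every element of `Z'` comes
from `Z`, then modulo the image of `d` every element of `Z'` comes from a finitely generated
module. -/
theorem IsApproximable.exists_fg_of_forall_exists {G Y : HilbMod.{u, v} T} {ρ : V →L[A] W}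
    (hρ : IsApproximable ρ) (Z : Submodule A V) (hZ : IsClosed (Z : Set V)) (Z' : Submodule A W)
    (hZ' : IsClosed (Z' : Set W)) (hρZ : ∀ x ∈ Z, ρ x ∈ Z') (r : W →L[A] Y) (d : G →L[A] Y)
    (h : ∀ z ∈ Z', ∃ w ∈ Z, ∃ y, r z = r (ρ w) + d y) :
    ∃ (L : FGHilbMod.{u, v} T) (j : L.toHilbMod →L[A] W), (∀ l, j l ∈ Z') ∧
      ∀ z ∈ Z', ∃ l y, r z = r (j l) + d y := by
  have : CompleteSpace Z' := hZ'.completeSpace_coe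
  have : CompleteSpace Z := hZ.completeSpace_coe
  -- The pullback of `Z'` and `Z` over the quotient of `Y` by the image of `d`.
  let m : (Z' × Z × G) →L[A] Y :=
    (r.comp Z'.subtypeL).comp (ContinuousLinearMap.fst A Z' (Z × G)) -
    ((r.comp ρ).comp Z.subtypeL).comp
      ((ContinuousLinearMap.fst A Z G).comp (ContinuousLinearMap.snd A Z' (Z × G))) -
    d.comp ((ContinuousLinearMap.snd A Z G).comp (ContinuousLinearMap.snd A Z' (Z × G)))
  let m' : (Z' × Z × G) →L[ℂ] Y := m.restrictScalars ℂ
  let E : Submodule ℂ (Z' × Z × G) := LinearMap.ker (m' : (Z' × Z × G) →ₗ[ℂ] Y)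
  have hE : IsClosed (E : Set (Z' × Z × G)) := m'.isClosed_ker
  have : CompleteSpace E := hE.completeSpace_coe
  let p : E →L[ℂ] Z' := (ContinuousLinearMap.fst ℂ Z' (Z × G)).comp E.subtypeL
  have hp : Function.Surjective p := fun z => by
    obtain ⟨w, hw, y, e⟩ := h z.1 z.2
    refine ⟨⟨(z, ⟨w, hw⟩, y), ?_⟩, rfl⟩
    change r z.1 - r (ρ w) - d y = 0
    rw [e]; abel
  -- With `v e = ρ w` for `e = (z, w, y)`, the perturbation `u` below is `π ∘ j ∘ a - v`; the
  -- projection `π` keeps the values in `Z'`, and it does not change `v`.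
  obtain ⟨δ, hδ, hsurj⟩ := p.exists_surjective_add_of_norm_lt hp
  obtain ⟨π, hπ, hπ_id, hπ_le⟩ := exists_proj Z' hZ'
  obtain ⟨L, a, j, haj⟩ := hρ (δ / 2) (by positivity)
  refine ⟨L, π.comp j, fun l => hπ _, fun z hz => ?_⟩
  let u : E →L[ℂ] Z' := (((π.comp (j.comp a - ρ)).restrictScalars ℂ).codRestrict
      (Z'.restrictScalars ℂ) fun x => hπ _).comp
    (((Z.restrictScalars ℂ).subtypeL.comp ((ContinuousLinearMap.fst ℂ Z G).comp
      (ContinuousLinearMap.snd ℂ Z' (Z × G)))).comp E.subtypeL)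
  have hu : ‖u‖ < δ := by
    refine (u.opNorm_le_bound (by positivity) fun e => ?_).trans_lt (half_lt_self hδ)
    refine (hπ_le _).trans ((haj _).trans (mul_le_mul_of_nonneg_left ?_ (by positivity)))
    exact (_root_.norm_fst_le e.1.2).trans (norm_snd_le e.1)
  obtain ⟨e, he⟩ := hsurj u hu ⟨z, hz⟩
  have hem : r e.1.1.1 - r (ρ e.1.2.1.1) - d e.1.2.2 = 0 := e.2
  have he' : e.1.1.1 + π (j (a e.1.2.1.1) - ρ e.1.2.1.1) = z := congrArg Subtype.val he
  refine ⟨a e.1.2.1.1, e.1.2.2, ?_⟩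
  rw [← he', map_sub, hπ_id _ (hρZ _ e.1.2.1.2), map_add, map_sub]
  rw [sub_sub, sub_eq_zero] at hem
  rw [hem]
  change _ = r (π (j (a e.1.2.1.1))) + _
  abel

end HilbMod

/-! ### Morphisms of montelian modules and qhtf complexes -/

lemma eventually_small_iff {p : ℝ → Prop} :
    (∀ᶠ t in 𝓝[>] (0 : ℝ), p t) ↔ ∃ s : ℝ, 0 < s ∧ ∀ t, 0 < t → t ≤ s → p t := by
  refine (mem_nhdsGT_iff_exists_Ioc_subset (s := {t | p t})).trans ?_
  exact exists_congr fun s => and_congr_right fun _ =>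
    ⟨fun h t ht hts => h ⟨ht, hts⟩, fun h t ht => h t ht.1 ht.2⟩

/-- A property of all sufficiently small `t` holds on some interval `]0, s]`, for every
sufficiently small `s`. -/
lemma eventually_forall_le {p : ℝ → Prop} (h : ∀ᶠ t in 𝓝[>] (0 : ℝ), p t) :
    ∀ᶠ s in 𝓝[>] (0 : ℝ), ∀ t, 0 < t → t ≤ s → p t := by
  obtain ⟨s, hs, h⟩ := eventually_small_iff.1 h
  exact eventually_small_iff.2 ⟨s, hs, fun t _ hts r hr hrt => h r hr (hrt.trans hts)⟩

lemma exists_pos_of_eventually_small {p : ℝ → Prop} (h : ∀ᶠ t in 𝓝[>] (0 : ℝ), p t) :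
    ∃ t, 0 < t ∧ p t := by
  obtain ⟨s, hs, h⟩ := eventually_small_iff.1 h
  exact ⟨s, hs, h s hs le_rfl⟩

namespace MontMod

section Morphisms

variable {U V W : MontMod.{u, v} T}

lemma Hom.mk_rep (φ : V ⟶ W) : (Quotient.mk _ (Hom.rep φ) : Hom V W) = φ := Quotient.out_eq φ

lemma Hom.rep_mk (φ : PreHom V W) :
    ∀ᶠ t in 𝓝[>] (0 : ℝ), (Hom.rep (Quotient.mk _ φ)).app t = φ.app t :=
  Quotient.exact (Quotient.out_eq (Quotient.mk _ φ))

lemma Hom.rep_comp (φ : U ⟶ V) (ψ : V ⟶ W) :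
    ∀ᶠ t in 𝓝[>] (0 : ℝ), (Hom.rep (φ ≫ ψ)).app t = ((Hom.rep ψ).app t).comp
      ((Hom.rep φ).app t) := by
  have h : φ ≫ ψ = Quotient.mk _ ((Hom.rep φ).comp (Hom.rep ψ)) := by
    conv_lhs => rw [← Hom.mk_rep φ, ← Hom.mk_rep ψ]
    rfl
  rw [h]
  exact Hom.rep_mk _

lemma Hom.rep_zero :
    ∀ᶠ t in 𝓝[>] (0 : ℝ), (Hom.rep (0 : V ⟶ W)).app t = 0 :=
  Hom.rep_mk (PreHom.zero V W)

lemma Hom.rep_id :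
    ∀ᶠ t in 𝓝[>] (0 : ℝ), (Hom.rep (𝟙 V)).app t = ContinuousLinearMap.id A (V.mod t) :=
  Hom.rep_mk (PreHom.id V)

lemma eventually_eq_zero_of_isZero (h : Limits.IsZero W) :
    ∀ᶠ t in 𝓝[>] (0 : ℝ), ∀ x : W.mod t, x = 0 := by
  have e : 𝟙 W = 0 := h.eq_of_src _ _
  have h₁ := Hom.rep_id (V := W)
  rw [e] at h₁
  filter_upwards [h₁, Hom.rep_zero (V := W) (W := W)] with t h₁ h₂ x
  have h₃ := DFunLike.congr_fun (h₁.symm.trans h₂) x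
  exact h₃

lemma PreHom.eventually_commOn (φ : PreHom V W) : ∀ᶠ s in 𝓝[>] (0 : ℝ), φ.CommOn s := by
  obtain ⟨s, hs, h⟩ := φ.comm
  exact eventually_small_iff.2 ⟨s, hs, fun r _ hr t t' ht' htt ht => h t t' ht' htt (ht.trans hr)⟩

lemma eventually_le_t₀ (W : MontMod.{u, v} T) : ∀ᶠ t in 𝓝[>] (0 : ℝ), t ≤ W.t₀ :=
  eventually_small_iff.2 ⟨W.t₀, W.t₀_pos, fun _ _ h => h⟩

/-- The image of an element of `V_*(t)` under a representative of a morphism, for small `t`. -/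
def PreHom.mapLim (φ : PreHom V W) {t : ℝ} (h : φ.CommOn t) (z : V.lim t) : W.lim t :=
  ⟨φ.star t z, φ.star_mem h le_rfl z⟩

/-- The element of `W_*(t)` given by the images of an element of `W(t)`. -/
def sectionOf (W : MontMod.{u, v} T) {t : ℝ} (ht : t ≤ W.t₀) (x : W.mod t) : W.lim t :=
  ⟨fun r => W.ρ t r x, fun r r' h =>
    (DFunLike.congr_fun (W.ρ_comp t r r' r'.2.1 h r.2.2.le ht) x).symm⟩

/-- The element of `L_*(t)` given by an element of a finitely generated projective module `L`. -/
def constSection (L : FGHilbMod.{u, v} T) (t : ℝ) (x : L.toHilbMod) : L.const.lim t :=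
  ⟨fun _ => x, fun _ _ _ => rfl⟩

/-- The value at `t` of a representative of a morphism from a finitely generated projective
module `L`, as a morphism from `L`. -/
def PreHom.constApp {L : FGHilbMod.{u, v} T} (φ : PreHom L.const W) (t : ℝ) :
    L.toHilbMod →L[A] W.mod t := φ.app t

lemma eq_constSection (L : FGHilbMod.{u, v} T) {t : ℝ} (ht : 0 < t) (z : L.const.lim t) :
    ∃ x : L.toHilbMod, z = constSection L t x := by
  refine ⟨z.1 ⟨t / 2, half_pos ht, half_lt_self ht⟩, Subtype.ext (funext fun r => ?_)⟩
  rcases le_total (r : ℝ) (t / 2) with h | h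
  · exact (z.2 ⟨t / 2, half_pos ht, half_lt_self ht⟩ r h).symm
  · exact z.2 r ⟨t / 2, half_pos ht, half_lt_self ht⟩ h

end Morphisms

section Complexes

variable {K L : CochainComplex (MontMod.{u, v} T) ℤ}

lemma eventually_comm (σ : K ⟶ L) (i j : ℤ) :
    ∀ᶠ t in 𝓝[>] (0 : ℝ), ((dRep L i j).app t).comp ((fRep σ i).app t) =
      ((fRep σ j).app t).comp ((dRep K i j).app t) := by
  have h := Hom.rep_comp (σ.f i) (L.d i j)
  rw [σ.comm] at h
  filter_upwards [h, Hom.rep_comp (K.d i j) (σ.f j)] with t h₁ h₂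
  exact h₁.symm.trans h₂

lemma eventually_chainOn (σ : K ⟶ L) (i : ℤ) : ∀ᶠ s in 𝓝[>] (0 : ℝ), ChainOn σ i s := by
  filter_upwards [(fRep σ i).eventually_commOn, (fRep σ (i - 1)).eventually_commOn,
    eventually_forall_le (eventually_comm σ i (i + 1)),
    eventually_forall_le (eventually_comm σ (i - 1) i)] with s h₁ h₂ h₃ h₄
  exact ⟨h₁, h₂, h₃, h₄⟩

lemma cohomMap_surjective_iff {σ : K ⟶ L} {i : ℤ} {s t t' : ℝ} (h : ChainOn σ i s) (htt : t' ≤ t)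
    (hts : t ≤ s) :
    Function.Surjective (cohomMap h htt hts) ↔
      ∀ z : (L.X i).lim t', (∀ r : Set.Ioo (0 : ℝ) t', (dRep L i (i + 1)).app r (z.1 r) = 0) →
        ∃ w : (K.X i).lim t, (∀ r : Set.Ioo (0 : ℝ) t, (dRep K i (i + 1)).app r (w.1 r) = 0) ∧
          ∃ y : (L.X (i - 1)).lim t', ∀ r : Set.Ioo (0 : ℝ) t',
            z.1 r = (fRep σ i).app r (((K.X i).res htt w).1 r) +
            (dRep L (i - 1) i).app r (y.1 r) := by
  constructor
  · intro hs z hz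
    obtain ⟨c, hc⟩ := hs (Submodule.Quotient.mk ⟨z, funext hz⟩)
    obtain ⟨w, rfl⟩ := Submodule.Quotient.mk_surjective _ c
    have hc' := (Submodule.Quotient.eq _).1 hc.symm
    obtain ⟨y, hy⟩ := hc'
    refine ⟨w.1, fun r => congrFun w.2 r, y, fun r => ?_⟩
    have e : (dRep L (i - 1) i).app r (y.1 r) =
      z.1 r - (fRep σ i).app r (((K.X i).res htt w.1).1 r) := congrFun hy r
    rw [e, add_sub_cancel]
  · intro hs c
    obtain ⟨z, rfl⟩ := Submodule.Quotient.mk_surjective _ c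
    obtain ⟨w, hw, y, hy⟩ := hs z.1 fun r => congrFun z.2 r
    refine ⟨Submodule.Quotient.mk ⟨w, funext hw⟩, Eq.symm ?_⟩
    refine (Submodule.Quotient.eq _).2 ⟨y, funext fun r => ?_⟩
    change _ = z.1.1 r - (fRep σ i).app r (((K.X i).res htt w).1 r)
    rw [hy r]
    exact (add_sub_cancel_left _ _).symm

lemma cohomMap_injective_iff {σ : K ⟶ L} {i : ℤ} {s t t' : ℝ} (h : ChainOn σ i s) (htt : t' ≤ t)
    (hts : t ≤ s) :
    Function.Injective (cohomMap h htt hts) ↔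
      ∀ w : (K.X i).lim t, (∀ r : Set.Ioo (0 : ℝ) t, (dRep K i (i + 1)).app r (w.1 r) = 0) →
        ∀ y : (L.X (i - 1)).lim t', (∀ r : Set.Ioo (0 : ℝ) t',
            (fRep σ i).app r (((K.X i).res htt w).1 r) = (dRep L (i - 1) i).app r (y.1 r)) →
          ∃ y' : (K.X (i - 1)).lim t, ∀ r : Set.Ioo (0 : ℝ) t,
            w.1 r = (dRep K (i - 1) i).app r (y'.1 r) := by
  rw [injective_iff_map_eq_zero]
  constructor
  · intro hs w hw y hy
    have h₀ := hs (Submodule.Quotient.mk ⟨w, funext hw⟩)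
      ((Submodule.Quotient.mk_eq_zero _).2 ⟨y, funext fun r => (hy r).symm⟩)
    obtain ⟨y', hy'⟩ := (Submodule.Quotient.mk_eq_zero _).1 h₀
    exact ⟨y', fun r => (congrFun hy' r).symm⟩
  · intro hs c hc
    obtain ⟨w, rfl⟩ := Submodule.Quotient.mk_surjective _ c
    obtain ⟨y, hy⟩ := (Submodule.Quotient.mk_eq_zero _).1 hc
    obtain ⟨y', hy'⟩ := hs w.1 (fun r => congrFun w.2 r) y fun r => (congrFun hy r).symm
    exact (Submodule.Quotient.mk_eq_zero _).2 ⟨y', funext fun r => (hy' r).symm⟩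

/-- In a qhtf complex, cycles extend to larger indices up to boundaries. -/
lemma IsQhtf.eventually_extend (hK : IsQhtf K) {i j k : ℤ} (hj : i + 1 = j) (hk : j + 1 = k) :
    ∀ᶠ t in 𝓝[>] (0 : ℝ), ∀ t' (_ : 0 < t') (htt : t' ≤ t) (z : (K.X j).lim t'),
      (∀ r : Set.Ioo (0 : ℝ) t', (dRep K j k).app r (z.1 r) = 0) →
        ∃ w : (K.X j).lim t, (∀ r : Set.Ioo (0 : ℝ) t, (dRep K j k).app r (w.1 r) = 0) ∧
          ∃ y : (K.X i).lim t', ∀ r : Set.Ioo (0 : ℝ) t',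
            z.1 r = ((K.X j).res htt w).1 r + (dRep K i j).app r (y.1 r) := by
  obtain rfl : i = j - 1 := by omega
  subst hk
  obtain ⟨s, hs, h, hbij⟩ := (hK j).2
  filter_upwards [eventually_small_iff.2 ⟨s, hs, fun t _ h => h⟩,
    eventually_forall_le (Hom.rep_id (V := K.X j))] with t hts hid t' ht' htt z hz
  obtain ⟨w, hw, y, hy⟩ := (cohomMap_surjective_iff h htt hts).1 (hbij t t' ht' htt hts) z hz
  refine ⟨w, hw, y, fun r => ?_⟩
  have e : (fRep (𝟙 K) j).app r = ContinuousLinearMap.id A _ :=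
    hid r r.2.1 (r.2.2.le.trans htt)
  rw [hy r, e]
  rfl

/-- In a qhtf complex, a cycle that becomes a boundary for smaller indices is a boundary. -/
lemma IsQhtf.eventually_bound (hK : IsQhtf K) {i j k : ℤ} (hj : i + 1 = j) (hk : j + 1 = k) :
    ∀ᶠ t in 𝓝[>] (0 : ℝ), ∀ t' (_ : 0 < t') (htt : t' ≤ t) (w : (K.X j).lim t),
      (∀ r : Set.Ioo (0 : ℝ) t, (dRep K j k).app r (w.1 r) = 0) → ∀ y : (K.X i).lim t',
        (∀ r : Set.Ioo (0 : ℝ) t', ((K.X j).res htt w).1 r = (dRep K i j).app r (y.1 r)) →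
          ∃ y' : (K.X i).lim t, ∀ r : Set.Ioo (0 : ℝ) t,
            w.1 r = (dRep K i j).app r (y'.1 r) := by
  obtain rfl : i = j - 1 := by omega
  subst hk
  obtain ⟨s, hs, h, hbij⟩ := (hK (j - 1)).1 j (by omega)
  filter_upwards [eventually_small_iff.2 ⟨s, hs, fun t _ h => h⟩,
    eventually_forall_le (Hom.rep_id (V := K.X j))] with t hts hid t' ht' htt w hw y hy
  refine (cohomMap_injective_iff h htt hts).1 (hbij t t' ht' htt hts).1 w hw y fun r => ?_
  have e : (fRep (𝟙 K) j).app r = ContinuousLinearMap.id A _ :=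
    hid r r.2.1 (r.2.2.le.trans htt)
  rw [e]
  exact hy r

end Complexes

end MontMod

/-! ### Generation of the cohomology of the cone -/

namespace MontMod

variable {F : CochainComplex (MontMod.{u, v} T) ℤ}

/-- Let `σ : M → F^j` be a morphism with values in the cycles of a qhtf complex. The pairs `(f, x)`
with `f ∈ F^i_*` and `x ∈ M` such that `d f = σ x`, that is to say the cycles of the cone of `σ`,
extend to larger indices up to boundaries of `F`. -/
lemma IsQhtf.eventually_extend_cone (hF : IsQhtf F) {h i j k : ℤ} (hi : h + 1 = i) (hj : i + 1 = j)
    (hk : j + 1 = k) (M : FGHilbMod.{u, v} T) (σ : PreHom M.const (F.X j))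
    (hσ : ∀ᶠ t in 𝓝[>] (0 : ℝ), ∀ x : M.toHilbMod, (dRep F j k).app t (σ.constApp t x) = 0) :
    ∀ᶠ t in 𝓝[>] (0 : ℝ), ∀ t' (_ : 0 < t') (htt : t' ≤ t) (f : (F.X i).lim t')
      (x : M.toHilbMod),
      (∀ r : Set.Ioo (0 : ℝ) t', (dRep F i j).app r (f.1 r) = σ.constApp r x) →
        ∃ g : (F.X i).lim t,
          (∀ r : Set.Ioo (0 : ℝ) t, (dRep F i j).app r (g.1 r) = σ.constApp r x) ∧
          ∃ y : (F.X h).lim t', ∀ r : Set.Ioo (0 : ℝ) t',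
            f.1 r = ((F.X i).res htt g).1 r + (dRep F h i).app r (y.1 r) := by
  filter_upwards [hF.eventually_extend hi hj, hF.eventually_bound hj hk, σ.eventually_commOn,
    eventually_forall_le hσ] with t hext hbd hcomm hσt t' ht' htt f x hf
  obtain ⟨f₀, hf₀⟩ := hbd t' ht' htt (σ.mapLim hcomm (constSection M t x))
    (fun r => hσt r r.2.1 r.2.2.le x) f fun r => (hf r).symm
  have hf₀' : ∀ r : Set.Ioo (0 : ℝ) t, (dRep F i j).app r (f₀.1 r) = σ.constApp r x :=
    fun r => (hf₀ r).symm
  obtain ⟨w, hw, y, hy⟩ := hext t' ht' htt (f - (F.X i).res htt f₀) fun r => by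
    change (dRep F i j).app r (f.1 r - ((F.X i).res htt f₀).1 r) = 0
    rw [map_sub, hf r, sub_eq_zero]
    exact (hf₀' (incl htt r)).symm
  refine ⟨f₀ + w, fun r => ?_, y, fun r => ?_⟩
  · change (dRep F i j).app r (f₀.1 r + w.1 r) = _
    rw [map_add, hf₀' r, hw r, add_zero]
  · have e : f.1 r - ((F.X i).res htt f₀).1 r =
        ((F.X i).res htt w).1 r + (dRep F h i).app r (y.1 r) := hy r
    rw [map_add]
    change _ = ((F.X i).res htt f₀).1 r + ((F.X i).res htt w).1 r + (dRep F h i).app r (y.1 r)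
    rw [add_assoc, ← e]
    exact (add_sub_cancel _ _).symm

/-- Let `σ : M → F^j` be a morphism with values in the cycles of a qhtf complex. The cohomology in
degree `i` of the cone of `σ` is generated by a finitely generated projective module. -/
theorem IsQhtf.exists_fg_generating_cone (hF : IsQhtf F) {h i j k : ℤ} (hi : h + 1 = i)
    (hj : i + 1 = j) (hk : j + 1 = k) (M : FGHilbMod.{u, v} T) (σ : PreHom M.const (F.X j))
    (hσ : ∀ᶠ t in 𝓝[>] (0 : ℝ), ∀ x : M.toHilbMod, (dRep F j k).app t (σ.constApp t x) = 0) :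
    ∃ (L : FGHilbMod.{u, v} T) (δ : L.toHilbMod →L[A] M.toHilbMod) (l : PreHom L.const (F.X i)),
      (∀ᶠ t in 𝓝[>] (0 : ℝ), ∀ x : L.toHilbMod,
        (dRep F i j).app t (l.constApp t x) = σ.constApp t (δ x)) ∧
      ∀ᶠ t in 𝓝[>] (0 : ℝ), ∀ (f : (F.X i).lim t) (x : M.toHilbMod),
        (∀ r : Set.Ioo (0 : ℝ) t, (dRep F i j).app r (f.1 r) = σ.constApp r x) →
          ∃ (z : L.toHilbMod) (y : (F.X h).lim t), x = δ z ∧ ∀ r : Set.Ioo (0 : ℝ) t,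
            f.1 r = l.constApp r z + (dRep F h i).app r (y.1 r) := by
  obtain ⟨s, hs, hext, hcσ, hcd, hcd', ht₀, ht₀'⟩ := exists_pos_of_eventually_small
    ((hF.eventually_extend_cone hi hj hk M σ hσ).and <| σ.eventually_commOn.and <|
      (dRep F i j).eventually_commOn.and <| (dRep F h i).eventually_commOn.and <|
      (eventually_le_t₀ (F.X i)).and (eventually_le_t₀ (F.X h)))
  -- Three indices in `]0, s[`: the boundaries are taken at `a`, and the restriction from `c` to `b`
  -- is the compact map of the argument.
  obtain ⟨a, b, c, ha, hab, hbc, hcs⟩ : ∃ a b c : ℝ, 0 < a ∧ a < b ∧ b < c ∧ c < s :=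
    ⟨s / 4, s / 2, 3 * s / 4, by linarith, by linarith, by linarith, by linarith⟩
  have hb : 0 < b := ha.trans hab
  have hc : 0 < c := hb.trans hbc
  let W := F.X i
  let N := M.toHilbMod
  -- The kernel `Z t` of `cyc t` consists of the cycles of the cone at the index `t`.
  let cyc (t : ℝ) : (W.mod t).prod N →L[A] (F.X j).mod t :=
    ((dRep F i j).app t).comp (HilbMod.fst (W.mod t) N) -
      (σ.constApp t).comp (HilbMod.snd (W.mod t) N)
  let Z (t : ℝ) : Submodule A ((W.mod t).prod N) :=
    LinearMap.ker (cyc t : (W.mod t).prod N →ₗ[A] (F.X j).mod t)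
  have hZ : ∀ t, IsClosed (Z t : Set ((W.mod t).prod N)) := fun t => (cyc t).isClosed_ker
  have hZ_mem : ∀ t (p : (W.mod t).prod N), p ∈ Z t ↔
      (dRep F i j).app t (HilbMod.fst _ _ p) = σ.constApp t (HilbMod.snd _ _ p) := fun t p =>
    sub_eq_zero
  let R (t t' : ℝ) : (W.mod t).prod N →L[A] (W.mod t').prod N :=
    HilbMod.lift ((W.ρ t t').comp (HilbMod.fst _ _)) (HilbMod.snd _ _)
  have hR : HilbMod.IsApproximable (R c b) :=
    (W.ρ_compact c b hb hbc (hcs.le.trans ht₀)).isApproximable.prod_id M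
  have hRZ : ∀ p ∈ Z c, R c b p ∈ Z b := fun p hp => by
    rw [hZ_mem] at hp ⊢
    have e₁ := DFunLike.congr_fun (hcd c b hb hbc.le hcs.le) (HilbMod.fst _ _ p)
    have e₂ := DFunLike.congr_fun (hcσ c b hb hbc.le hcs.le) (HilbMod.snd _ _ p)
    change (dRep F i j).app b (W.ρ c b (HilbMod.fst _ _ p)) = σ.constApp b (HilbMod.snd _ _ p)
    refine e₁.trans (Eq.trans ?_ e₂.symm)
    exact congrArg ((F.X j).ρ c b) hp
  obtain ⟨L, J, hJ, hL⟩ := hR.exists_fg_of_forall_exists (Z c) (hZ c) (Z b) (hZ b) hRZ (R b a)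
    (HilbMod.lift ((dRep F h i).app a) (0 : (F.X h).mod a →L[A] N)) (fun p hp => by
      have hp' := (hZ_mem b p).1 hp
      obtain ⟨g, hg, y, hy⟩ := hext b hb (hbc.trans hcs).le
        (W.sectionOf ((hbc.trans hcs).le.trans ht₀) (HilbMod.fst _ _ p)) (HilbMod.snd _ _ p)
        fun r => by
          have e₁ := DFunLike.congr_fun (hcd b r r.2.1 r.2.2.le (hbc.trans hcs).le)
            (HilbMod.fst _ _ p)
          have e₂ := DFunLike.congr_fun (hcσ b r r.2.1 r.2.2.le (hbc.trans hcs).le)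
            (HilbMod.snd _ _ p)
          refine e₁.trans (Eq.trans ?_ e₂.symm)
          exact congrArg ((F.X j).ρ b r) hp'
      let c' : Set.Ioo (0 : ℝ) s := ⟨c, hc, hcs⟩
      let b' : Set.Ioo (0 : ℝ) s := ⟨b, hb, hbc.trans hcs⟩
      let a' : Set.Ioo (0 : ℝ) s := ⟨a, ha, hab.trans (hbc.trans hcs)⟩
      refine ⟨HilbMod.pair (g.1 c') (HilbMod.snd _ _ p), (hZ_mem c _).2 (hg c'),
        y.1 ⟨a, ha, hab⟩, HilbMod.prod_ext ?_ ?_⟩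
      · have e : W.ρ b a (W.ρ c b (g.1 c')) = g.1 a' := by
          have e₁ : W.ρ c b (g.1 c') = g.1 b' := g.2 c' b' hbc.le
          rw [e₁]
          exact g.2 b' a' hab.le
        rw [map_add]
        change W.ρ b a (HilbMod.fst _ _ p) = W.ρ b a (W.ρ c b (g.1 c')) + _
        rw [e]
        exact hy ⟨a, ha, hab⟩
      · rw [map_add]
        exact (add_zero (HilbMod.snd _ _ p)).symm)
  let δ : L.toHilbMod →L[A] N := (HilbMod.snd _ _).comp J
  let l₀ : L.toHilbMod →L[A] W.mod b := (HilbMod.fst _ _).comp J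
  -- The commutation of `W.ρ b t` with the maps `ρ` is only meaningful, and only needed, for `t ≤ b`.
  refine ⟨L, δ, ⟨fun t => (W.ρ b t).comp l₀, b, hb, fun t t' ht' htt ht => ?_⟩, ?_, ?_⟩
  · ext x
    exact DFunLike.congr_fun (W.ρ_comp b t t' ht' htt ht ((hbc.trans hcs).le.trans ht₀)) (l₀ x)
  · refine eventually_small_iff.2 ⟨b, hb, fun t ht htb x => ?_⟩
    have e₁ := DFunLike.congr_fun (hcd b t ht htb (hbc.trans hcs).le) (l₀ x)
    have e₂ := DFunLike.congr_fun (hcσ b t ht htb (hbc.trans hcs).le) (δ x)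
    refine e₁.trans (Eq.trans ?_ e₂.symm)
    exact congrArg ((F.X j).ρ b t) ((hZ_mem b _).1 (hJ x))
  · refine eventually_small_iff.2 ⟨a, ha, fun t ht hta f x hf => ?_⟩
    have hts : t ≤ s := hta.trans (hab.trans (hbc.trans hcs)).le
    obtain ⟨g, hg, y, hy⟩ := hext t ht hts f x hf
    let b' : Set.Ioo (0 : ℝ) s := ⟨b, hb, hbc.trans hcs⟩
    obtain ⟨z, y', e⟩ := hL (HilbMod.pair (g.1 b') x) ((hZ_mem b _).2 (hg b'))
    have e₁ : W.ρ b a (g.1 b') = W.ρ b a (l₀ z) + (dRep F h i).app a y' := by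
      have := congrArg (HilbMod.fst _ _) e
      rw [map_add] at this
      exact this
    have e₂ : x = δ z := by
      have := congrArg (HilbMod.snd _ _) e
      rw [map_add] at this
      exact this.trans (add_zero _)
    have has : a ≤ s := (hab.trans (hbc.trans hcs)).le
    have hbs : b ≤ s := (hbc.trans hcs).le
    refine ⟨z, y + (F.X h).res hta ((F.X h).sectionOf (has.trans ht₀') y'), e₂, fun r => ?_⟩
    have hra : (r : ℝ) ≤ a := r.2.2.le.trans hta
    have hg' : ((F.X i).res hts g).1 r = W.ρ a r (W.ρ b a (g.1 b')) := by
      have e₃ := g.2 b' (incl hts r) (hra.trans hab.le)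
      refine e₃.symm.trans ?_
      exact DFunLike.congr_fun (W.ρ_comp b a r r.2.1 hra hab.le (hbs.trans ht₀)) (g.1 b')
    have hl : W.ρ b r (l₀ z) = W.ρ a r (W.ρ b a (l₀ z)) :=
      DFunLike.congr_fun (W.ρ_comp b a r r.2.1 hra hab.le (hbs.trans ht₀)) (l₀ z)
    have hd : W.ρ a r ((dRep F h i).app a y') = (dRep F h i).app r ((F.X h).ρ a r y') :=
      (DFunLike.congr_fun (hcd' a r r.2.1 hra has) y').symm
    rw [hy r, hg', e₁, map_add, hd, ← hl]
    change _ = W.ρ b r (l₀ z) + (dRep F h i).app r (y.1 r + (F.X h).ρ a r y')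
    rw [map_add]
    abel

end MontMod

/-! ### Complexes of finitely generated modules -/

namespace FGHilbMod

/-- The continuous linear map underlying a morphism of finitely generated projective modules. -/
def toCLM {V W : FGHilbMod.{u, v} T} (f : V ⟶ W) : V.toHilbMod →L[A] W.toHilbMod := f

lemma isZero_of_forall_eq_zero {W : FGHilbMod.{u, v} T} (h : ∀ x : W.toHilbMod, x = 0) :
    Limits.IsZero W := by
  rw [Limits.IsZero.iff_id_eq_zero]
  exact ContinuousLinearMap.ext (M₁ := W.toHilbMod) (M₂ := W.toHilbMod) fun x => h x

lemma eq_zero_of_isZero {W : FGHilbMod.{u, v} T} (h : Limits.IsZero W) (x : W.toHilbMod) : x = 0 :=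
  DFunLike.congr_fun (F := W.toHilbMod →L[A] W.toHilbMod) (h.eq_of_src (𝟙 W) 0) x

lemma toCLM_d_comp_d (P : CochainComplex (FGHilbMod.{u, v} T) ℤ) (i j k : ℤ)
    (x : (P.X i).toHilbMod) : toCLM (P.d j k) (toCLM (P.d i j) x) = 0 :=
  DFunLike.congr_fun (F := (P.X i).toHilbMod →L[A] (P.X k).toHilbMod) (P.d_comp_d i j k) x

end FGHilbMod

open FGHilbMod

namespace MontMod

variable {F : CochainComplex (MontMod.{u, v} T) ℤ} {P : CochainComplex (FGHilbMod.{u, v} T) ℤ}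

/-- A representative of a component of a morphism from a complex of finitely generated projective
modules. -/
def constRep (σ : toMont P ⟶ F) (i : ℤ) : PreHom (P.X i).const (F.X i) := fRep σ i

lemma eventually_dRep_toMont (P : CochainComplex (FGHilbMod.{u, v} T) ℤ) (i j : ℤ) :
    ∀ᶠ t in 𝓝[>] (0 : ℝ), (dRep (toMont P) i j).app t = toCLM (P.d i j) :=
  Hom.rep_mk _

lemma eventually_comm_toMont (σ : toMont P ⟶ F) (i j : ℤ) :
    ∀ᶠ t in 𝓝[>] (0 : ℝ), ∀ x : (P.X i).toHilbMod,
      (dRep F i j).app t ((constRep σ i).constApp t x) =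
        (constRep σ j).constApp t (toCLM (P.d i j) x) := by
  filter_upwards [eventually_comm σ i j, eventually_dRep_toMont P i j] with t h₁ h₂ x
  rw [h₂] at h₁
  exact DFunLike.congr_fun h₁ x

/-- A morphism is a qi-morphism as soon as its cone is acyclic. -/
theorem isQi_of_cone_exact {σ : toMont P ⟶ F}
    (hex : ∀ h i j k : ℤ, h + 1 = i → i + 1 = j → j + 1 = k → ∀ᶠ t in 𝓝[>] (0 : ℝ),
      ∀ (f : (F.X i).lim t) (x : (P.X j).toHilbMod), toCLM (P.d j k) x = 0 →
        (∀ r : Set.Ioo (0 : ℝ) t, (dRep F i j).app r (f.1 r) = (constRep σ j).constApp r x) →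
          ∃ (z : (P.X i).toHilbMod) (y : (F.X h).lim t), x = toCLM (P.d i j) z ∧
            ∀ r : Set.Ioo (0 : ℝ) t,
              f.1 r = (constRep σ i).constApp r z + (dRep F h i).app r (y.1 r)) :
    IsQi σ := by
  suffices H : ∀ i, ∃ s : ℝ, 0 < s ∧ ∃ h : ChainOn σ i s,
      ∀ t t' (_ : 0 < t') (htt : t' ≤ t) (hts : t ≤ s), Function.Bijective (cohomMap h htt hts) by
    intro q
    refine ⟨fun i _ => H i, ?_⟩
    obtain ⟨s, hs, h, hb⟩ := H q
    exact ⟨s, hs, h, fun t t' ht' htt hts => (hb t t' ht' htt hts).2⟩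
  intro i
  obtain ⟨s, hs, hchain, hd, hd', hex₁, hex₂⟩ := exists_pos_of_eventually_small
    ((eventually_chainOn σ i).and <|
      (eventually_forall_le (eventually_dRep_toMont P i (i + 1))).and <|
      (eventually_forall_le (eventually_dRep_toMont P (i - 1) i)).and <|
      (eventually_forall_le (hex (i - 1) i (i + 1) (i + 1 + 1) (by omega) rfl rfl)).and
      (eventually_forall_le (hex (i - 1 - 1) (i - 1) i (i + 1) (by omega) (by omega) rfl)))
  refine ⟨s, hs, hchain, fun t t' ht' htt hts => ⟨?_, ?_⟩⟩
  · rw [cohomMap_injective_iff]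
    intro w hw y hy
    obtain ⟨x, rfl⟩ := eq_constSection (P.X i) (ht'.trans_le htt) w
    have ht := ht'.trans_le htt
    let r₀ : Set.Ioo (0 : ℝ) t := ⟨t / 2, half_pos ht, half_lt_self ht⟩
    have hx : toCLM (P.d i (i + 1)) x = 0 := by
      have e := hw r₀
      rw [hd r₀ r₀.2.1 (r₀.2.2.le.trans hts)] at e
      exact e
    -- `(y, x)` is a cycle of degree `i - 1` of the cone.
    obtain ⟨z, -, hz, -⟩ := hex₂ t' ht' (htt.trans hts) y x hx fun r => (hy r).symm
    refine ⟨constSection (P.X (i - 1)) t z, fun r => ?_⟩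
    rw [hd' r r.2.1 (r.2.2.le.trans hts)]
    exact hz
  · rw [cohomMap_surjective_iff]
    intro f hf
    -- `(f, 0)` is a cycle of degree `i` of the cone.
    obtain ⟨z, y, hz, hy⟩ := hex₁ t' ht' (htt.trans hts) f 0 (map_zero _) fun r => by
      rw [map_zero]; exact hf r
    refine ⟨constSection (P.X i) t z, fun r => ?_, y, hy⟩
    rw [hd r r.2.1 (r.2.2.le.trans hts)]
    exact hz.symm

/-! ### The inductive construction -/

variable {Q : CochainComplex (FGHilbMod.{u, v} T) ℤ}

/-- A degree of a factorisation `Q → P → F` of `φ` under construction: the module `X = P^i`, the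
cycles `Z ⊆ P^i`, and the components in degree `i` of the morphisms `P → F` and `Q → P`. -/
structure Stage (φ : toMont Q ⟶ F) (i : ℤ) where
  X : FGHilbMod.{u, v} T
  Z : Submodule A X.toHilbMod
  isClosed_Z : IsClosed (Z : Set X.toHilbMod)
  σ : PreHom X.const (F.X i)
  ψ : (Q.X i).toHilbMod →L[A] X.toHilbMod
  d_σ : ∀ j, i + 1 = j → ∀ᶠ t in 𝓝[>] (0 : ℝ), ∀ x ∈ Z, (dRep F i j).app t (σ.constApp t x) = 0
  ψ_d : ∀ h x, ψ (toCLM (Q.d h i) x) ∈ Z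
  fac : ∀ᶠ t in 𝓝[>] (0 : ℝ), ∀ x, (constRep φ i).constApp t x = σ.constApp t (ψ x)

namespace Stage

variable {φ : toMont Q ⟶ F} {i j : ℤ}

/-- The morphism `d : P^i → P^j`, `j = i + 1`, is a differential with the given cycles, commutes
with `P → F` and `Q → P`, and makes the cone of `P → F` acyclic in degree `i`. -/
structure IsLink (s : Stage φ i) (s' : Stage φ j) (d : s.X.toHilbMod →L[A] s'.X.toHilbMod) :
    Prop where
  mem_Z : ∀ x, x ∈ s.Z ↔ d x = 0
  d_mem : ∀ x, d x ∈ s'.Z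
  d_ψ : ∀ x, d (s.ψ x) = s'.ψ (toCLM (Q.d i j) x)
  d_σ : ∀ᶠ t in 𝓝[>] (0 : ℝ), ∀ x, (dRep F i j).app t (s.σ.constApp t x) = s'.σ.constApp t (d x)
  exact : ∀ h, h + 1 = i → ∀ᶠ t in 𝓝[>] (0 : ℝ), ∀ (f : (F.X i).lim t), ∀ x ∈ s'.Z,
    (∀ r : Set.Ioo (0 : ℝ) t, (dRep F i j).app r (f.1 r) = s'.σ.constApp r x) →
      ∃ (z : s.X.toHilbMod) (y : (F.X h).lim t), x = d z ∧ ∀ r : Set.Ioo (0 : ℝ) t,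
        f.1 r = s.σ.constApp r z + (dRep F h i).app r (y.1 r)

/-- The complexes vanish around degree `i`, so that `P^i` can be chosen as small as possible. -/
def Vanishes (F : CochainComplex (MontMod.{u, v} T) ℤ) (Q : CochainComplex (FGHilbMod.{u, v} T) ℤ)
    (i : ℤ) : Prop :=
  Limits.IsZero (F.X i) ∧ Limits.IsZero (F.X (i + 1)) ∧ Limits.IsZero (Q.X i)

lemma eventually_lim_eq_zero {W : MontMod.{u, v} T} (h : Limits.IsZero W) :
    ∀ᶠ t in 𝓝[>] (0 : ℝ), ∀ (f : W.lim t) (r : Set.Ioo (0 : ℝ) t), f.1 r = 0 := by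
  filter_upwards [eventually_forall_le (eventually_eq_zero_of_isZero h)] with t ht f r
  exact ht r r.2.1 r.2.2.le _

/-- Above the degrees where the complexes live, `P` is `Q`. -/
def top (φ : toMont Q ⟶ F) {i : ℤ} (hF : ∀ j, i + 1 = j → Limits.IsZero (F.X j)) : Stage φ i where
  X := Q.X i
  Z := ⊤
  isClosed_Z := isClosed_univ
  σ := constRep φ i
  ψ := ContinuousLinearMap.id A _
  d_σ j hj := by
    filter_upwards [eventually_eq_zero_of_isZero (hF j hj)] with t ht x _
    exact ht _
  ψ_d _ _ := trivial
  fac := Eventually.of_forall fun _ _ => rfl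

lemma isLink_top (hFi : Limits.IsZero (F.X i)) (hQi : Limits.IsZero (Q.X i))
    (hQj : Limits.IsZero (Q.X j))
    (hF : ∀ k, i + 1 = k → Limits.IsZero (F.X k)) (hF' : ∀ k, j + 1 = k → Limits.IsZero (F.X k)) :
    IsLink (top φ hF) (top φ hF') (toCLM (Q.d i j)) where
  mem_Z x := by
    obtain rfl : x = 0 := eq_zero_of_isZero hQi x
    simp
  d_mem _ := trivial
  d_ψ _ := rfl
  d_σ := eventually_comm_toMont φ i j
  exact h hi := by
    filter_upwards [eventually_lim_eq_zero hFi] with t ht f x _ _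
    refine ⟨0, 0, (eq_zero_of_isZero hQj x).trans (map_zero _).symm, fun r => ?_⟩
    rw [ht f r, map_zero, zero_add]
    exact (map_zero _).symm

/-- Where the complexes vanish, one can take for `P^i` the cycles of degree `i + 1`. -/
theorem exists_isLink_of_vanishes (hv : Vanishes F Q i) (hj : i + 1 = j) (s' : Stage φ j) :
    ∃ (s : Stage φ i) (d : _), IsLink s s' d ∧
      s.Z = ⊥ ∧ (s'.Z = ⊥ → ∀ x : s.X.toHilbMod, x = 0) := by
  subst hj
  obtain ⟨hFi, hFj, hQi⟩ := hv
  let X := s'.X.ofClosed s'.Z s'.isClosed_Z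
  let d : X.toHilbMod →L[A] s'.X.toHilbMod := HilbMod.incl s'.Z s'.isClosed_Z
  have hd : Function.Injective d := HilbMod.incl_injective _ _
  refine ⟨⟨X, ⊥, isClosed_singleton, PreHom.zero _ _, 0, fun j _ => ?_, fun h x => ?_, ?_⟩, d,
    ⟨fun x => ?_, fun x => HilbMod.incl_mem _ _ x, fun x => ?_, ?_, fun h hi => ?_⟩, rfl,
    fun hZ x => ?_⟩
  · exact Eventually.of_forall fun t x _ => map_zero _
  · exact Submodule.zero_mem _
  · refine Eventually.of_forall fun t x => ?_
    rw [eq_zero_of_isZero hQi x, map_zero]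
    rfl
  · rw [Submodule.mem_bot]
    exact (map_eq_zero_iff d hd).symm
  · rw [eq_zero_of_isZero hQi x, map_zero, map_zero, map_zero, map_zero]
  · filter_upwards [eventually_eq_zero_of_isZero hFj] with t ht x
    exact (ht _).trans (ht _).symm
  · filter_upwards [eventually_lim_eq_zero hFi] with t ht f x hx _
    refine ⟨⟨x, hx⟩, 0, rfl, fun r => ?_⟩
    rw [ht f r]
    exact ((zero_add _).trans (map_zero ((dRep F h i).app r))).symm
  · refine hd ((Submodule.mem_bot A).1 ?_ |>.trans (map_zero d).symm)
    rw [← hZ]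
    exact HilbMod.incl_mem _ _ x

/-- The inductive step: `P^i` is the direct sum of `Q^i` and of a finitely generated module that
generates the cohomology of degree `i` of the cone of `P → F`. -/
theorem exists_isLink (hF : IsQhtf F) (hj : i + 1 = j) (s' : Stage φ j) :
    ∃ (s : Stage φ i) (d : _), IsLink s s' d := by
  let M := s'.X.ofClosed s'.Z s'.isClosed_Z
  let ι : M.toHilbMod →L[A] s'.X.toHilbMod := HilbMod.incl s'.Z s'.isClosed_Z
  let τ : PreHom M.const (F.X j) :=
    ⟨fun t => (s'.σ.constApp t).comp ι, by
      obtain ⟨s, hs, h⟩ := s'.σ.comm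
      exact ⟨s, hs, fun t t' ht' htt hts =>
        ContinuousLinearMap.ext fun x => DFunLike.congr_fun (h t t' ht' htt hts) (ι x)⟩⟩
  have hτ : ∀ t x, τ.constApp t x = s'.σ.constApp t (ι x) := fun _ _ => rfl
  obtain ⟨L, δ, l, hl, hgen⟩ := hF.exists_fg_generating_cone (h := i - 1) (by omega) hj rfl M τ (by
    filter_upwards [s'.d_σ _ rfl] with t ht x
    exact ht (ι x) (HilbMod.incl_mem _ _ x))
  let X := (Q.X i).prod L
  let p₁ : X.toHilbMod →L[A] (Q.X i).toHilbMod := HilbMod.fst _ _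
  let p₂ : X.toHilbMod →L[A] L.toHilbMod := HilbMod.snd _ _
  let d : X.toHilbMod →L[A] s'.X.toHilbMod :=
    s'.ψ.comp ((toCLM (Q.d i j)).comp p₁) + ι.comp (δ.comp p₂)
  let ψ : (Q.X i).toHilbMod →L[A] X.toHilbMod := HilbMod.lift (ContinuousLinearMap.id A _) 0
  let σ : PreHom X.const (F.X i) :=
    ⟨fun t => ((constRep φ i).constApp t).comp p₁ + (l.constApp t).comp p₂, by
      obtain ⟨s, hs, h₁, h₂⟩ := exists_pos_of_eventually_small
        ((constRep φ i).eventually_commOn.and l.eventually_commOn)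
      refine ⟨s, hs, fun t t' ht' htt hts => ContinuousLinearMap.ext fun x => ?_⟩
      have e₁ := DFunLike.congr_fun (h₁ t t' ht' htt hts) (p₁ x)
      have e₂ := DFunLike.congr_fun (h₂ t t' ht' htt hts) (p₂ x)
      exact (congrArg₂ (· + ·) e₁ e₂).trans (map_add ((F.X i).ρ t t') _ _).symm⟩
  have hσ : ∀ t x, σ.constApp t x = (constRep φ i).constApp t (p₁ x) + l.constApp t (p₂ x) :=
    fun _ _ => rfl
  have hd : ∀ x, d x = s'.ψ (toCLM (Q.d i j) (p₁ x)) + ι (δ (p₂ x)) := fun _ => rfl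
  have hdψ : ∀ x, d (ψ x) = s'.ψ (toCLM (Q.d i j) x) := fun x => by
    rw [hd]
    change s'.ψ (toCLM (Q.d i j) x) + ι (δ 0) = _
    rw [map_zero, map_zero, add_zero]
  have hdσ : ∀ᶠ t in 𝓝[>] (0 : ℝ), ∀ x, (dRep F i j).app t (σ.constApp t x) =
      s'.σ.constApp t (d x) := by
    filter_upwards [hl, eventually_comm_toMont φ i j, s'.fac] with t h₁ h₂ h₃ x
    rw [hσ, map_add, h₁, h₂, h₃, hd, map_add, hτ]
  have hex : ∀ᶠ t in 𝓝[>] (0 : ℝ), ∀ (f : (F.X i).lim t), ∀ x ∈ s'.Z,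
      (∀ r : Set.Ioo (0 : ℝ) t, (dRep F i j).app r (f.1 r) = s'.σ.constApp r x) →
        ∃ (z : X.toHilbMod) (y : (F.X (i - 1)).lim t), x = d z ∧ ∀ r : Set.Ioo (0 : ℝ) t,
          f.1 r = σ.constApp r z + (dRep F (i - 1) i).app r (y.1 r) := by
    filter_upwards [hgen] with t ht f x hx hfx
    obtain ⟨x', hx'⟩ : ∃ x', ι x' = x := HilbMod.exists_incl_eq _ _ hx
    obtain ⟨z, y, hz, hy⟩ := ht f x' fun r => by rw [hfx r, hτ, hx']
    obtain ⟨e, he₁, he₂⟩ : ∃ e, p₁ e = 0 ∧ p₂ e = z := ⟨HilbMod.pair 0 z, rfl, rfl⟩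
    refine ⟨e, y, ?_, fun r => ?_⟩
    · rw [hd, he₁, he₂, map_zero, map_zero, zero_add, ← hz, hx']
    · rw [hy r, hσ, he₁, he₂, map_zero, zero_add]
  refine ⟨⟨X, LinearMap.ker (d : X.toHilbMod →ₗ[A] s'.X.toHilbMod), d.isClosed_ker, σ, ψ,
    fun k hk => ?_, fun h x => ?_, ?_⟩, d,
    ⟨fun x => Iff.rfl, fun x => ?_, hdψ, hdσ, fun h hi => ?_⟩⟩
  · obtain rfl : j = k := hj.symm.trans hk
    filter_upwards [hdσ] with t ht x hx
    rw [ht, show d x = 0 from hx]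
    exact map_zero _
  · change d (ψ _) = 0
    rw [hdψ, toCLM_d_comp_d, map_zero]
  · refine Eventually.of_forall fun t x => ?_
    rw [hσ]
    change _ = (constRep φ i).constApp t x + l.constApp t 0
    rw [map_zero, add_zero]
  · rw [hd]
    exact s'.Z.add_mem (s'.ψ_d _ _) (HilbMod.incl_mem _ _ _)
  · obtain rfl : h = i - 1 := by omega
    exact hex

end Stage

end MontMod

/-! ### Factorisation through a qi-morphism -/

namespace MontMod

variable {F : CochainComplex (MontMod.{u, v} T) ℤ} {Q : CochainComplex (FGHilbMod.{u, v} T) ℤ}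

/-- A sequence of linked stages is a factorisation of `φ` through a qi-morphism. -/
theorem exists_factorization_of_isLink (φ : toMont Q ⟶ F) (s : ∀ i, Stage φ i)
    (d : ∀ i, (s i).X.toHilbMod →L[A] (s (i + 1)).X.toHilbMod)
    (hd : ∀ i, Stage.IsLink (s i) (s (i + 1)) (d i)) :
    ∃ (P : CochainComplex (FGHilbMod.{u, v} T) ℤ) (σ : toMont P ⟶ F) (ψ : Q ⟶ P),
      (∀ i, P.X i = (s i).X) ∧ IsQi σ ∧ φ = toMontMap ψ ≫ σ := by
  have hdd : ∀ i x, d (i + 1) (d i x) = 0 := fun i x => ((hd (i + 1)).mem_Z _).1 ((hd i).d_mem x)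
  let P : CochainComplex (FGHilbMod.{u, v} T) ℤ := CochainComplex.of (fun i => (s i).X)
    (fun i => (d i : (s i).X ⟶ (s (i + 1)).X)) fun i => ContinuousLinearMap.ext (hdd i)
  have hP : ∀ i, P.d i (i + 1) = (d i : (s i).X ⟶ (s (i + 1)).X) := fun i =>
    CochainComplex.of_d (fun i => (s i).X) (fun i => (d i : (s i).X ⟶ (s (i + 1)).X)) i
  let σ : toMont P ⟶ F :=
    { f := fun i => (Quotient.mk _ (s i).σ : Hom (s i).X.const (F.X i))
      comm' := by
        rintro i _ rfl
        change (Quotient.mk _ (s i).σ : Hom (s i).X.const (F.X i)) ≫ F.d i (i + 1) =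
          (constFunctor T).map (P.d i (i + 1)) ≫
            (Quotient.mk _ (s (i + 1)).σ : Hom (s (i + 1)).X.const (F.X (i + 1)))
        rw [hP, ← Hom.mk_rep (F.d i (i + 1))]
        refine Quotient.sound ((hd i).d_σ.mono fun t ht => ?_)
        exact ContinuousLinearMap.ext ht }
  have hσ : ∀ i, ∀ᶠ t in 𝓝[>] (0 : ℝ), (constRep σ i).constApp t = (s i).σ.constApp t :=
    fun i => Hom.rep_mk (s i).σ
  let ψ : Q ⟶ P :=
    { f := fun i => ((s i).ψ : Q.X i ⟶ (s i).X)
      comm' := by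
        rintro i _ rfl
        rw [hP]
        exact ContinuousLinearMap.ext (hd i).d_ψ }
  refine ⟨P, σ, ψ, fun _ => rfl, isQi_of_cone_exact ?_, ?_⟩
  · rintro h i _ _ hi rfl rfl
    filter_upwards [(hd i).exact h hi, eventually_forall_le (hσ i),
      eventually_forall_le (hσ (i + 1))] with t ht h₁ h₂ f x hx hf
    rw [hP] at hx
    obtain ⟨z, y, hz, hy⟩ := ht f x (((hd (i + 1)).mem_Z x).2 hx) fun r => by
      rw [hf r, h₂ r r.2.1 r.2.2.le]
    refine ⟨z, y, ?_, fun r => ?_⟩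
    · rw [hP]; exact hz
    · rw [hy r, h₁ r r.2.1 r.2.2.le]
  · ext i
    change φ.f i = (constFunctor T).map ((s i).ψ : Q.X i ⟶ (s i).X) ≫
      (Quotient.mk _ (s i).σ : Hom (s i).X.const (F.X i))
    rw [← Hom.mk_rep (φ.f i)]
    refine Quotient.sound ((s i).fac.mono fun t ht => ?_)
    exact ContinuousLinearMap.ext ht

/-- Every morphism `Q → F` factors through a qi-morphism `P → F`, where `P` vanishes in the degrees
above those of `F` and `Q`, and extends at most two degrees below them. -/
theorem exists_factorization (hF : IsQhtf F) (φ : toMont Q ⟶ F) {b : ℤ}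
    (hFb : ∀ i, b < i → Limits.IsZero (F.X i)) (hQb : ∀ i, b < i → Limits.IsZero (Q.X i)) :
    ∃ (P : CochainComplex (FGHilbMod.{u, v} T) ℤ) (σ : toMont P ⟶ F) (ψ : Q ⟶ P),
      ((∀ i, b < i → Limits.IsZero (P.X i)) ∧
        ∀ a, (∀ i, i < a → Limits.IsZero (F.X i)) → (∀ i, i < a → Limits.IsZero (Q.X i)) →
          ∀ i, i < a - 2 → Limits.IsZero (P.X i)) ∧
      IsQi σ ∧ φ = toMontMap ψ ≫ σ := by
  have hF' : ∀ i, b < i → ∀ j, i + 1 = j → Limits.IsZero (F.X j) :=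
    fun i hi j hj => hFb j (by omega)
  obtain ⟨s, hs, hs_top⟩ := exists_descending_family (S := Stage φ)
    (fun i s s' => (∃ d, Stage.IsLink s s' d) ∧ (Stage.Vanishes F Q i →
      s.Z = ⊥ ∧ (s'.Z = ⊥ → ∀ x : s.X.toHilbMod, x = 0))) b
    (fun i hi => Stage.top φ (hF' i hi))
    (fun i hi => by
      refine ⟨⟨_, Stage.isLink_top (hFb i hi) (hQb i hi) (hQb (i + 1) (by omega)) _ _⟩, fun _ => ?_⟩
      have h₀ : ∀ x : (Stage.top φ (hF' i hi)).X.toHilbMod, x = 0 := eq_zero_of_isZero (hQb i hi)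
      exact ⟨(Submodule.eq_bot_iff _).2 fun x _ => h₀ x, fun _ => h₀⟩)
    (fun i s' => by
      by_cases hv : Stage.Vanishes F Q i
      · obtain ⟨s, d, h, h'⟩ := Stage.exists_isLink_of_vanishes hv rfl s'
        exact ⟨s, ⟨d, h⟩, fun _ => h'⟩
      · obtain ⟨s, d, h⟩ := Stage.exists_isLink hF rfl s'
        exact ⟨s, ⟨d, h⟩, fun h => absurd h hv⟩)
  choose d hd using fun i => (hs i).1
  obtain ⟨P, σ, ψ, hP, hσ, hfac⟩ := exists_factorization_of_isLink φ s d hd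
  refine ⟨P, σ, ψ, ⟨fun i hi => ?_, fun a hFa hQa i hi => ?_⟩, hσ, hfac⟩
  · rw [hP, hs_top i hi]
    exact hQb i hi
  · have hv : ∀ j, j < a - 1 → Stage.Vanishes F Q j := fun j hj =>
      ⟨hFa j (by omega), hFa (j + 1) (by omega), hQa j (by omega)⟩
    rw [hP]
    exact isZero_of_forall_eq_zero (((hs i).2 (hv i (by omega))).2
      ((hs (i + 1)).2 (hv (i + 1) (by omega))).1)

end MontMod

/-- There is a zero object, namely the zero submodule of any given module. -/
theorem FGHilbMod.exists_isZero (W : HilbMod.{u, v} T) :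
    ∃ L : FGHilbMod.{u, v} T, Limits.IsZero L := by
  let L := W.ofClosed ⊥ isClosed_singleton
  have h₀ : ∀ x : L, x = 0 := fun x => Subsingleton.elim (α := (⊥ : Submodule A W)) x 0
  refine ⟨⟨L, 0, 0, fun x => ?_⟩, isZero_of_forall_eq_zero h₀⟩
  rw [h₀ x, map_zero, norm_zero, norm_zero]

/-- The zero complex of finitely generated projective modules, and its morphism to `F`. -/
theorem MontMod.exists_zero_complex (F : CochainComplex (MontMod.{u, v} T) ℤ) :
    ∃ (Q : CochainComplex (FGHilbMod.{u, v} T) ℤ) (_ : toMont Q ⟶ F),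
      ∀ i, Limits.IsZero (Q.X i) := by
  obtain ⟨L, hL⟩ := FGHilbMod.exists_isZero ((F.X 0).mod 0)
  exact ⟨CochainComplex.of (fun _ => L) (fun _ => 0) fun _ => Limits.zero_comp, 0, fun _ => hL⟩

end Modules

end

theorem mainTheorem4 {A : Type u} [Ring A] [Algebra ℂ A] [StarRing A] [StarModule ℂ A]
    (T : FiniteVNA A) :
    -- finite complexes
    (∀ F : CochainComplex (MontMod.{u, v} T) ℤ, IsFiniteComplex F → MontMod.IsQhtf F →
      (∃ (P : CochainComplex (FGHilbMod.{u, v} T) ℤ) (σ : toMont P ⟶ F),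
        IsFiniteComplex P ∧ MontMod.IsQi σ) ∧
      (∀ (Q : CochainComplex (FGHilbMod.{u, v} T) ℤ) (φ : toMont Q ⟶ F), IsFiniteComplex Q →
        ∃ (P : CochainComplex (FGHilbMod.{u, v} T) ℤ) (σ : toMont P ⟶ F) (ψ : Q ⟶ P),
          IsFiniteComplex P ∧ MontMod.IsQi σ ∧ φ = toMontMap ψ ≫ σ)) ∧
    -- bounded above complexes
    (∀ F : CochainComplex (MontMod.{u, v} T) ℤ, IsBoundedAbove F → MontMod.IsQhtf F →
      (∃ (P : CochainComplex (FGHilbMod.{u, v} T) ℤ) (σ : toMont P ⟶ F),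
        IsBoundedAbove P ∧ MontMod.IsQi σ) ∧
      (∀ (Q : CochainComplex (FGHilbMod.{u, v} T) ℤ) (φ : toMont Q ⟶ F), IsBoundedAbove Q →
        ∃ (P : CochainComplex (FGHilbMod.{u, v} T) ℤ) (σ : toMont P ⟶ F) (ψ : Q ⟶ P),
          IsBoundedAbove P ∧ MontMod.IsQi σ ∧ φ = toMontMap ψ ≫ σ)) := by
  have hfin : ∀ F : CochainComplex (MontMod.{u, v} T) ℤ, IsFiniteComplex F → MontMod.IsQhtf F →
      ∀ (Q : CochainComplex (FGHilbMod.{u, v} T) ℤ) (φ : toMont Q ⟶ F), IsFiniteComplex Q →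
        ∃ (P : CochainComplex (FGHilbMod.{u, v} T) ℤ) (σ : toMont P ⟶ F) (ψ : Q ⟶ P),
          IsFiniteComplex P ∧ MontMod.IsQi σ ∧ φ = toMontMap ψ ≫ σ := by
    rintro F ⟨a, b, hab⟩ hF Q φ ⟨a', b', hab'⟩
    obtain ⟨P, σ, ψ, ⟨hb, ha⟩, h⟩ := MontMod.exists_factorization hF φ (b := max b b')
      (fun i hi => hab i (Or.inr (by omega))) (fun i hi => hab' i (Or.inr (by omega)))
    refine ⟨P, σ, ψ, ⟨min a a' - 2, max b b', fun i hi => hi.elim (ha _ ?_ ?_ i) (hb i)⟩, h⟩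
    · exact fun i hi => hab i (Or.inl (by omega))
    · exact fun i hi => hab' i (Or.inl (by omega))
  have hbdd : ∀ F : CochainComplex (MontMod.{u, v} T) ℤ, IsBoundedAbove F → MontMod.IsQhtf F →
      ∀ (Q : CochainComplex (FGHilbMod.{u, v} T) ℤ) (φ : toMont Q ⟶ F), IsBoundedAbove Q →
        ∃ (P : CochainComplex (FGHilbMod.{u, v} T) ℤ) (σ : toMont P ⟶ F) (ψ : Q ⟶ P),
          IsBoundedAbove P ∧ MontMod.IsQi σ ∧ φ = toMontMap ψ ≫ σ := by
    rintro F ⟨b, hb⟩ hF Q φ ⟨b', hb'⟩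
    obtain ⟨P, σ, ψ, ⟨h', -⟩, h⟩ := MontMod.exists_factorization hF φ (b := max b b')
      (fun i hi => hb i (by omega)) (fun i hi => hb' i (by omega))
    exact ⟨P, σ, ψ, ⟨_, h'⟩, h⟩
  refine ⟨fun F h hF => ⟨?_, hfin F h hF⟩, fun F h hF => ⟨?_, hbdd F h hF⟩⟩
  · obtain ⟨Q, φ, hQ⟩ := MontMod.exists_zero_complex F
    obtain ⟨P, σ, -, hP, hσ, -⟩ := hfin F h hF Q φ ⟨0, 0, fun i _ => hQ i⟩
    exact ⟨P, σ, hP, hσ⟩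
  · obtain ⟨Q, φ, hQ⟩ := MontMod.exists_zero_complex F
    obtain ⟨P, σ, -, hP, hσ, -⟩ := hbdd F h hF Q φ ⟨0, fun i _ => hQ i⟩
    exact ⟨P, σ, hP, hσ⟩
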